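/- Let $\mathcal X$ be a finite nonempty set of arms and $P$ a finite set of priors. Each $p\in P$ has a mean function $\mu_{1,p}:\mathcal X\to\mathbb R$ and a positive semidefinite kernel $k_{1,p}:\mathcal X\times\mathcal X\to\mathbb R$ with $k_{1,p}(x,x)\le 1$ for all $x$. Let $P_1$ be a probability distribution on $P$ (the hyperprior), $\sigma>0$ and $T\in\mathbb N$. Let $p^*\sim P_1$ and, given $p^*$, let $f\sim\mathcal{GP}(\mu_{1,p^*},k_{1,p^*})$. Playing an arm $x_t$ in round $t$ yields $y_t=f(x_t)+\epsilon_t$ with $\epsilon_1,\dots,\epsilon_T$ i.i.d. $\mathcal N(0,\sigma^2)$; each $\epsilon_t$ is independent of $p^*$, $f$, everything in earlier rounds, and the choices of round $t$. Let $H_t=\{(x_i,y_i)\}_{i<t}$, with $\mathbf y=(y_i)_{i<t}$, $\boldsymbol\mu_p=(\mu_{1,p}(x_i))_{i<t}$, $\mathbf K_p=(k_{1,p}(x_i,x_j))_{i,j<t}$ and $\mathbf k_p(x)=(k_{1,p}(x_i,x))_{i<t}$. The posterior mean and kernel of the prior $p$ are $$\mu_{t,p}(x)=\mu_{1,p}(x)+\mathbf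 k_p(x)^\top(\mathbf K_p+\sigma^2I)^{-1}(\mathbf y-\boldsymbol\mu_p),\qquad k_{t,p}(x,\tilde x)=k_{1,p}(x,\tilde x)-\mathbf k_p(x)^\top(\mathbf K_p+\sigma^2I)^{-1}\mathbf k_p(\tilde x),$$ and $\sigma_{t,p}^2(x)=k_{t,p}(x,x)$. Fix a measurable rule that assigns to each $g:\mathcal X\to\mathbb R$ a maximiser $\operatorname{argmax} g\in\mathcal X$, and put $x^*=\operatorname{argmax} f$. HP-GP-TS does the following in round $t=1,\dots,T$: given the past, it samples $p_t\sim P_t$ and then $\tilde f_t\sim\mathcal{GP}(\mu_{t,p_t},k_{t,p_t})$, plays $x_t=\operatorname{argmax}\tilde f_t$, observes $y_t$, and updates the hyperposterior by $$P_{t+1}(p)\propto \mathcal N\big(y_t;\mu_{t,p}(x_t),\sigma_{t,p}^2(x_t)+\sigma^2\big)\,P_t(p).$$ Let $\beta_t=2\log\big(|\mathcal X|t^2/\sqrt{2\pi}\big)$, $U_{t,p}(x)=\mu_{t,p}(x)+\sqrt{\beta_t}\,\sigma_{t,p}(x)$ and $C=2/\log(1+\sigma^{-2})$, where the square root of a negative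 number is read as $0$ (this only matters for $\beta_1$ when $|\mathcal X|\le 2$). For $p\in P$ let $\gamma_{T,p}$ be the maximum information gain $\sup_A I_p(\mathbf y_A;f)$ over all finite sequences $A=(a_1,\dots,a_n)$ of arms with $n\le T$, repetitions allowed. Here $f\sim\mathcal{GP}(\mu_{1,p},k_{1,p})$, $\mathbf y_A=(f(a_i)+e_i)_{i\le n}$ with $e_i$ i.i.d. $\mathcal N(0,\sigma^2)$ independent of $f$, and $I_p(\mathbf y_A;f)=H(\mathbf y_A\mid p)-H(\mathbf y_A\mid f,p)$ with $H$ the differential entropy. Let $\bar\gamma_T=\mathbb E_{p\sim P_1}[\gamma_{T,p}]$. Then the regret $\sum_{t=1}^T\big(f(x^*)-f(x_t)\big)$ and the variables $U_{t,p^*}(x^*)-U_{t,p_t}(x^*)$, $t\le T$, are integrable, and the Bayesian regret $\mathrm{BR}(T)=\mathbb E\big[\sum_{t=1}^T (f(x^*)-f(x_t))\big]$ of HP-GP-TS satisfies $$\mathrm{BR}(T)\le\frac{\pi^2}{6}+\sum_{t=1}^T\mathbb E\big[U_{t,p^*}(x^*)-U_{t,p_t}(x^*)\big]+\sqrt{C\,T\,\beta_T\,\bar\gamma_T}.$$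 -/

import Mathlib

open MeasureTheory ProbabilityTheory
open scoped NNReal ENNReal Matrix

namespace HPGP

noncomputable section

/-- The law on `X → ℝ` (with `X` finite) of a Gaussian process with mean function `m` and kernel
`k`: the multivariate Gaussian with mean vector `m` and covariance matrix `(k x x')`. -/
def gpLaw {X : Type*} [Fintype X] [DecidableEq X] (m : X → ℝ) (k : X → X → ℝ) :
    Measure (X → ℝ) :=
  (multivariateGaussian (WithLp.toLp 2 m) (Matrix.of k)).map WithLp.ofLp

/-! ### Posterior mean and kernel given a history `(xs i, ys i)`, `i < n` -/

/-- The regularised Gram matrix `K + σ² I` of the queried arms. -/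
def gram {X : Type*} (k : X → X → ℝ) (σ : ℝ≥0) {n : ℕ} (xs : Fin n → X) :
    Matrix (Fin n) (Fin n) ℝ :=
  Matrix.of (fun i j => k (xs i) (xs j)) + ((σ : ℝ) ^ 2) • (1 : Matrix (Fin n) (Fin n) ℝ)

/-- `μ_t(x) = μ(x) + kᵀ (K + σ² I)⁻¹ (y - μ)`. -/
def postMean {X : Type*} (m : X → ℝ) (k : X → X → ℝ) (σ : ℝ≥0) {n : ℕ}
    (xs : Fin n → X) (ys : Fin n → ℝ) (x : X) : ℝ :=
  m x + (fun i => k (xs i) x) ⬝ᵥ ((gram k σ xs)⁻¹ *ᵥ (fun i => ys i - m (xs i)))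

/-- `k_t(x, x') = k(x, x') - kᵀ (K + σ² I)⁻¹ k'`. -/
def postKer {X : Type*} (k : X → X → ℝ) (σ : ℝ≥0) {n : ℕ}
    (xs : Fin n → X) (x x' : X) : ℝ :=
  k x x' - (fun i => k (xs i) x) ⬝ᵥ ((gram k σ xs)⁻¹ *ᵥ (fun i => k (xs i) x'))

/-- The upper confidence bound `μ_t(x) + √β σ_t(x)`. Here `√β = 0` if `β < 0`. -/
def ucb {X : Type*} (m : X → ℝ) (k : X → X → ℝ) (σ : ℝ≥0) (β : ℝ) {n : ℕ}
    (xs : Fin n → X) (ys : Fin n → ℝ) (x : X) : ℝ :=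
  postMean m k σ xs ys x + Real.sqrt β * Real.sqrt (postKer k σ xs x x)

/-- The hyperposterior after the `n` observations `(xs i, ys i)`: it starts at the hyperprior `P₁`
and is multiplied, at every observation, by the predictive likelihood
`N(y; μ_{t,p}(x), σ²_{t,p}(x) + σ²)` and renormalised. -/
def hyperPost {X P : Type*} [Fintype P] (P₁ : PMF P) (m : P → X → ℝ) (k : P → X → X → ℝ)
    (σ : ℝ≥0) : (n : ℕ) → (Fin n → X) → (Fin n → ℝ) → P → ℝ
  | 0, _, _, p => (P₁ p).toReal
  | n + 1, xs, ys, p =>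
    let xs' : Fin n → X := fun i => xs i.castSucc
    let ys' : Fin n → ℝ := fun i => ys i.castSucc
    let x := xs (Fin.last n)
    let w : P → ℝ := fun q =>
      gaussianPDFReal (postMean (m q) (k q) σ xs' ys' x)
        (Real.toNNReal (postKer (k q) σ xs' x x + (σ : ℝ) ^ 2)) (ys (Fin.last n))
        * hyperPost P₁ m k σ n xs' ys' q
    w p / ∑ q, w q

/-! ### Information gain -/

/-- Differential entropy `-∫ log (dν/dλ) dν` of a law `ν` on `ℝⁿ` with a Lebesgue density. -/
def diffEntropy {n : ℕ} (ν : Measure (Fin n → ℝ)) : ℝ :=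
  -∫ y, Real.log ((ν.rnDeriv volume y).toReal) ∂ν

/-- The law of a vector of `n` independent `N(0, σ²)` noise variables. -/
def noiseLaw (σ : ℝ≥0) (n : ℕ) : Measure (Fin n → ℝ) :=
  Measure.pi (fun _ => gaussianReal 0 (σ ^ 2))

/-- The mutual information `I(y_A ; f) = H(y_A) - H(y_A | f)` between `f ∼ GP(m, k)` and the noisy
observations `y_A = (f (A i) + e i)_{i < n}` at the locations `A 0, …, A (n - 1)`. -/
def infoGain {X : Type*} [Fintype X] [DecidableEq X] (m : X → ℝ) (k : X → X → ℝ) (σ : ℝ≥0)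
    {n : ℕ} (A : Fin n → X) : ℝ :=
  diffEntropy (((gpLaw m k).prod (noiseLaw σ n)).map (fun z i => z.1 (A i) + z.2 i))
    - ∫ g, diffEntropy ((noiseLaw σ n).map (fun e i => g (A i) + e i)) ∂(gpLaw m k)

/-- The maximum information gain: the supremum of `infoGain` over all collections of at most `T`
locations, where a location may be queried repeatedly. -/
def maxInfoGain {X : Type*} [Fintype X] [DecidableEq X] (m : X → ℝ) (k : X → X → ℝ) (σ : ℝ≥0)
    (T : ℕ) : ℝ :=
  ⨆ A : (Σ n : Fin (T + 1), (Fin n → X)), infoGain m k σ A.2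

/-- The maximum information gain averaged over the hyperprior. -/
def avgMaxInfoGain {X P : Type*} [Fintype X] [DecidableEq X] [Fintype P] (P₁ : PMF P)
    (m : P → X → ℝ) (k : P → X → X → ℝ) (σ : ℝ≥0) (T : ℕ) : ℝ :=
  ∑ p, (P₁ p).toReal * maxInfoGain (m p) (k p) σ T

/-! ### The algorithm

Rounds are numbered from `0`: index `t` is the round with number `t + 1`, before which `t`
observations have been made. `f` is the reward function, `ft t` the function sampled by the
algorithm, `pt t` the sampled prior and `ε t` the noise. The arm played is `am (ft t)`, where `am`
chooses a maximiser of a function on the arms. -/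

section Run

variable {Ω X P : Type*}

/-- The arms played before round `t`. -/
def armsBefore (am : (X → ℝ) → X) (ft : ℕ → Ω → X → ℝ) (t : ℕ) (ω : Ω) : Fin t → X :=
  fun i => am (ft i ω)

/-- The rewards `f(x_i) + ε_i` observed before round `t`. -/
def rewardsBefore (am : (X → ℝ) → X) (f : Ω → X → ℝ) (ft : ℕ → Ω → X → ℝ) (ε : ℕ → Ω → ℝ)
    (t : ℕ) (ω : Ω) : Fin t → ℝ :=
  fun i => f ω (am (ft i ω)) + ε i ω

/-- Everything random that is determined before round `t`: the true prior, the reward function,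
and the sampled priors, sampled functions and noises of the earlier rounds. -/
def pastBefore (pstar : Ω → P) (f : Ω → X → ℝ) (pt : ℕ → Ω → P) (ft : ℕ → Ω → X → ℝ)
    (ε : ℕ → Ω → ℝ) (t : ℕ) (ω : Ω) : (P × (X → ℝ)) × (Fin t → P × (X → ℝ) × ℝ) :=
  ((pstar ω, f ω), fun i => (pt i ω, ft i ω, ε i ω))

/-- The random variables `pstar, f, pt, ft, ε` on `(Ω, μ)` are a run of HyperPrior GP Thompson
sampling over `T` rounds. -/
structure IsRun [MeasurableSpace Ω] [Fintype X] [DecidableEq X] [Fintype P] [MeasurableSpace P]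
    (P₁ : PMF P) (m : P → X → ℝ) (k : P → X → X → ℝ) (σ : ℝ≥0) (am : (X → ℝ) → X) (T : ℕ)
    (μ : Measure Ω) (pstar : Ω → P) (f : Ω → X → ℝ) (pt : ℕ → Ω → P) (ft : ℕ → Ω → X → ℝ)
    (ε : ℕ → Ω → ℝ) : Prop where
  measurable_pstar : Measurable pstar
  measurable_f : Measurable f
  measurable_pt : ∀ t < T, Measurable (pt t)
  measurable_ft : ∀ t < T, Measurable (ft t)
  measurable_noise : ∀ t < T, Measurable (ε t)
  /-- `p* ∼ P₁`, and `f ∼ GP(μ_{1,p}, k_{1,p})` given `p* = p`. -/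
  law_prior : ∀ p, ∀ B : Set (X → ℝ), MeasurableSet B →
    μ {ω | pstar ω = p ∧ f ω ∈ B} = P₁ p * gpLaw (m p) (k p) B
  /-- Given the past, `p_t` is drawn from the hyperposterior, and then the sampled function from
  the posterior Gaussian process of the prior `p_t`. -/
  law_sample : ∀ t < T, ∀ q, ∀ B : Set (X → ℝ), MeasurableSet B →
    μ⟦{ω | pt t ω = q ∧ ft t ω ∈ B} |
        MeasurableSpace.comap (pastBefore pstar f pt ft ε t) inferInstance⟧
      =ᵐ[μ] fun ω =>
        hyperPost P₁ m k σ t (armsBefore am ft t ω) (rewardsBefore am f ft ε t ω) q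
          * (gpLaw (postMean (m q) (k q) σ (armsBefore am ft t ω) (rewardsBefore am f ft ε t ω))
              (postKer (k q) σ (armsBefore am ft t ω))).real B
  /-- The noise is `N(0, σ²)` and independent of the past and of the choices of its round. -/
  law_noise : ∀ t < T, HasLaw (ε t) (gaussianReal 0 (σ ^ 2)) μ
  indep_noise : ∀ t < T, IndepFun (ε t)
    (fun ω => (pastBefore pstar f pt ft ε t ω, pt t ω, ft t ω)) μ

end Run

/-- The cumulative regret `∑_{t ≤ T} f(x*) - f(x_t)`. -/
def regret {Ω X : Type*} (am : (X → ℝ) → X) (f : Ω → X → ℝ) (ft : ℕ → Ω → X → ℝ) (T : ℕ)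
    (ω : Ω) : ℝ :=
  ∑ t ∈ Finset.range T, (f ω (am (f ω)) - f ω (am (ft t ω)))

/-- `β_t = 2 log(|X| t² / √(2π))`. -/
def beta (X : Type*) [Fintype X] (t : ℕ) : ℝ :=
  2 * Real.log ((Fintype.card X : ℝ) * (t : ℝ) ^ 2 / Real.sqrt (2 * Real.pi))

/-- `U_{t+1,p}(x)`: the upper confidence bound at `x` under the prior with mean `m` and kernel `k`
at index `t` (round `t + 1`), computed from the history of the run. -/
def runUcb {Ω X : Type*} [Fintype X] (m : X → ℝ) (k : X → X → ℝ) (σ : ℝ≥0) (am : (X → ℝ) → X)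
    (f : Ω → X → ℝ) (ft : ℕ → Ω → X → ℝ) (ε : ℕ → Ω → ℝ) (t : ℕ) (ω : Ω) (x : X) : ℝ :=
  ucb m k σ (beta X (t + 1)) (armsBefore am ft t ω) (rewardsBefore am f ft ε t ω) x

end

end HPGP

namespace HPGP
noncomputable section

/-! Split the regret of a round into f(x*) - U_{p*}(x*), U_{p*}(x*) - U_{p_t}(x*) and U_{p_t}(x*) -
f(x_t). The middle term stays in the bound. The outer two are controlled by one fact: given the
history, the true pair (p*, f) and the sampled pair (p_t, f̃_t) are independent and both follow the
hyperposterior (`IsRun.lintegral_posterior`, `IsRun.lintegral_pair`).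

This fact is proved by induction on the round. An observation changes the posterior mean and kernel
by a rank-one correction (`postMean_succ`, `postKer_succ`), which is Gaussian conditioning
(`gpLaw_bayes`). Mixing over priors, the normaliser of the hyperposterior update is the predictive
density of the mixture (`lintegral_hyperKernel_bayes`). The adaptive choice of arms does no harm,
because the law of the sample depends on the past only through the history.

First term: conditionally, f(x) is Gaussian with variance at most 1, and β_t is tuned so that the
expected excesses over the confidence bounds, summed over all arms, equal at most 1/t². Summing over
rounds gives π²/6. Third term: exchanging the two pairs turns E[U_{p_t}(x*)] into E[U_{p*}(x_t)],
while E[f(x_t)] is the expected posterior mean under p* at x_t. What remains is the expected width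
√β_t σ_{t,p*}(x_t) (`IsRun.integral_runUcb_sub_reward`).

The widths are summed path by path. By the chain rule for entropy, an observation adds half of log(1
+ σ_t²/σ²) to the information gain (`infoGain_succ`), and Bernoulli's inequality compares this with
σ_t² (`le_log_div_log`). Cauchy–Schwarz then gives a bound with γ_{T,p*} under the root
(`sum_width_le`), and Jensen's inequality over p* moves the average inside (`sum_mul_sqrt_le`). -/

/-- The kriging interpolant `z ↦ k(xs, z)ᵀ (K + σ² I)⁻¹ b`. -/
def krig {X : Type*} (k : X → X → ℝ) (σ : ℝ≥0) {n : ℕ} (xs : Fin n → X) (b : Fin n → ℝ)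
    (z : X) : ℝ :=
  (fun i => k (xs i) z) ⬝ᵥ ((gram k σ xs)⁻¹ *ᵥ b)

/-- The mean function after one observation `y` at `x`. -/
def stepMean {X : Type*} (m : X → ℝ) (k : X → X → ℝ) (σ : ℝ≥0) (x : X) (y : ℝ) (z : X) : ℝ :=
  m z + (y - m x) / (k x x + (σ : ℝ) ^ 2) * k x z

/-- The kernel after one observation at `x`. -/
def stepKer {X : Type*} (k : X → X → ℝ) (σ : ℝ≥0) (x z z' : X) : ℝ :=
  k z z' - k x z * k x z' / (k x x + (σ : ℝ) ^ 2)

/-! ### Rank-one updates of the posterior mean and kernel. -/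

section LinearAlgebra

variable {X : Type*} {k : X → X → ℝ}

lemma kernel_symm (hk : (Matrix.of k).PosSemidef) (x y : X) : k x y = k y x := by
  have := hk.isHermitian.apply x y
  simpa using this.symm

lemma kernel_diag_nonneg (hk : (Matrix.of k).PosSemidef) (x : X) : 0 ≤ k x x := by
  classical
  simpa using hk.diag_nonneg (i := x)

lemma gram_posDef (hk : (Matrix.of k).PosSemidef) {σ : ℝ≥0} (hσ : 0 < σ) {n : ℕ}
    (xs : Fin n → X) : (gram k σ xs).PosDef := by
  have h1 : (Matrix.of (fun i j => k (xs i) (xs j))).PosSemidef := hk.submatrix xs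
  have h2 : (((σ : ℝ) ^ 2) • (1 : Matrix (Fin n) (Fin n) ℝ)).PosDef :=
    Matrix.PosDef.one.smul (by positivity)
  exact Matrix.PosDef.posSemidef_add h1 h2

lemma gram_mulVec_inv (hk : (Matrix.of k).PosSemidef) {σ : ℝ≥0} (hσ : 0 < σ) {n : ℕ}
    (xs : Fin n → X) (b : Fin n → ℝ) : gram k σ xs *ᵥ ((gram k σ xs)⁻¹ *ᵥ b) = b := by
  have := (gram_posDef hk hσ xs).isUnit
  rw [Matrix.mulVec_mulVec, Matrix.mul_nonsing_inv _ ((Matrix.isUnit_iff_isUnit_det _).1 this),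
    Matrix.one_mulVec]

lemma gram_inv_unique (hk : (Matrix.of k).PosSemidef) {σ : ℝ≥0} (hσ : 0 < σ) {n : ℕ}
    (xs : Fin n → X) (b v : Fin n → ℝ) (h : gram k σ xs *ᵥ v = b) :
    (gram k σ xs)⁻¹ *ᵥ b = v := by
  have := (gram_posDef hk hσ xs).isUnit
  rw [← h, Matrix.mulVec_mulVec, Matrix.nonsing_inv_mul _ ((Matrix.isUnit_iff_isUnit_det _).1 this),
    Matrix.one_mulVec]

lemma gram_mulVec_apply (σ : ℝ≥0) {n : ℕ} (xs : Fin n → X) (v : Fin n → ℝ) (i : Fin n) :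
    (gram k σ xs *ᵥ v) i = ∑ j, k (xs i) (xs j) * v j + (σ : ℝ) ^ 2 * v i := by
  rw [gram, Matrix.add_mulVec, Matrix.smul_mulVec, Matrix.one_mulVec]
  simp [Matrix.mulVec, dotProduct]

/-- The inverse Gram matrix is symmetric, so the bilinear form it defines is too. -/
lemma krig_symm (hk : (Matrix.of k).PosSemidef) {σ : ℝ≥0} (hσ : 0 < σ) {n : ℕ}
    (xs : Fin n → X) (z z' : X) :
    krig k σ xs (fun i => k (xs i) z) z' = krig k σ xs (fun i => k (xs i) z') z := by
  unfold krig
  have h : ((gram k σ xs)⁻¹)ᵀ = (gram k σ xs)⁻¹ := by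
    have := (gram_posDef hk hσ xs).isHermitian.inv
    simpa [Matrix.IsHermitian, Matrix.conjTranspose_eq_transpose_of_trivial] using this
  rw [Matrix.dotProduct_mulVec, dotProduct_comm, ← Matrix.mulVec_transpose, h]

/-- Adding one observation changes the interpolant by a rank-one correction. -/
lemma krig_succ (hk : (Matrix.of k).PosSemidef) {σ : ℝ≥0} (hσ : 0 < σ) {n : ℕ}
    (xs : Fin (n + 1) → X) (b : Fin (n + 1) → ℝ) (z : X)
    (hs : postKer k σ (fun i => xs (Fin.castSucc i)) (xs (Fin.last n)) (xs (Fin.last n))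
      + (σ : ℝ) ^ 2 ≠ 0) :
    krig k σ xs b z = krig k σ (fun i => xs (Fin.castSucc i)) (fun i => b (Fin.castSucc i)) z
      + (b (Fin.last n) - krig k σ (fun i => xs (Fin.castSucc i)) (fun i => b (Fin.castSucc i))
          (xs (Fin.last n)))
        / (postKer k σ (fun i => xs (Fin.castSucc i)) (xs (Fin.last n)) (xs (Fin.last n))
            + (σ : ℝ) ^ 2)
        * postKer k σ (fun i => xs (Fin.castSucc i)) (xs (Fin.last n)) z := by
  set xs' : Fin n → X := fun i => xs (Fin.castSucc i) with hxs'
  set b' : Fin n → ℝ := fun i => b (Fin.castSucc i) with hb'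
  set x := xs (Fin.last n) with hx
  set s := postKer k σ xs' x x + (σ : ℝ) ^ 2 with hsdef
  set v := (gram k σ xs')⁻¹ *ᵥ b' with hv
  set u := (gram k σ xs')⁻¹ *ᵥ (fun i => k (xs' i) x) with hu
  set c := (b (Fin.last n) - krig k σ xs' b' x) / s with hc
  have hvi := fun i => congrFun (gram_mulVec_inv hk hσ xs' b') i
  have hui := fun i => congrFun (gram_mulVec_inv hk hσ xs' (fun i => k (xs' i) x)) i
  simp only [← hv, ← hu, gram_mulVec_apply] at hvi hui
  -- Solving the bordered system: elimination of the first `n` coordinates leaves the Schur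
  -- complement `s` as pivot, so the last coordinate is `c` and the others move by `-c * u`.
  have key : (gram k σ xs)⁻¹ *ᵥ b = Fin.snoc (α := fun _ => ℝ) (fun i => v i - c * u i) c := by
    apply gram_inv_unique hk hσ
    ext i
    rw [gram_mulVec_apply, Fin.sum_univ_castSucc]
    refine Fin.lastCases ?_ (fun i => ?_) i
    · simp only [Fin.snoc_castSucc, Fin.snoc_last]
      have e1 : krig k σ xs' b' x = ∑ j, k x (xs' j) * v j := by
        simp only [krig, dotProduct, ← hv]
        exact Finset.sum_congr rfl fun j _ => by rw [kernel_symm hk]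
      have e2 : postKer k σ xs' x x = k x x - ∑ j, k x (xs' j) * u j := by
        simp only [postKer, dotProduct, ← hu]
        congr 1
        exact Finset.sum_congr rfl fun j _ => by rw [kernel_symm hk]
      have e3 : c * s = b (Fin.last n) - ∑ j, k x (xs' j) * v j := by
        rw [hc, div_mul_cancel₀ _ hs, e1]
      rw [hsdef, e2] at e3
      have e4 : ∑ j, k x (xs' j) * (v j - c * u j)
          = ∑ j, k x (xs' j) * v j - c * ∑ j, k x (xs' j) * u j := by
        rw [Finset.mul_sum, ← Finset.sum_sub_distrib]
        exact Finset.sum_congr rfl fun j _ => by ring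
      change ∑ j, k x (xs' j) * (v j - c * u j) + k x x * c + _ = _
      rw [e4]; linarith
    · simp only [Fin.snoc_castSucc, Fin.snoc_last]
      have e4 : ∑ j, k (xs' i) (xs' j) * (v j - c * u j)
          = ∑ j, k (xs' i) (xs' j) * v j - c * ∑ j, k (xs' i) (xs' j) * u j := by
        rw [Finset.mul_sum, ← Finset.sum_sub_distrib]
        exact Finset.sum_congr rfl fun j _ => by ring
      change ∑ j, k (xs' i) (xs' j) * (v j - c * u j) + k (xs' i) x * c + _ = b' i
      rw [e4]
      linear_combination hvi i - c * hui i
  have e5 : krig k σ xs' (fun i => k (xs' i) z) x = krig k σ xs' (fun i => k (xs' i) x) z :=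
    krig_symm hk hσ xs' z x
  have e6 : postKer k σ xs' x z = k x z - ∑ j, k (xs' j) z * u j := by
    change k x z - krig k σ xs' (fun i => k (xs' i) z) x = _
    rw [e5]
    simp only [krig, dotProduct, ← hu]
  rw [e6]
  simp only [krig, key, dotProduct, Fin.sum_univ_castSucc, Fin.snoc_castSucc, Fin.snoc_last, ← hv]
  change ∑ j, k (xs' j) z * (v j - c * u j) + k x z * c = _
  have e4 : ∑ j, k (xs' j) z * (v j - c * u j)
      = ∑ j, k (xs' j) z * v j - c * ∑ j, k (xs' j) z * u j := by
    rw [Finset.mul_sum, ← Finset.sum_sub_distrib]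
    exact Finset.sum_congr rfl fun j _ => by ring
  rw [e4]; ring

lemma postKer_zero (k : X → X → ℝ) (σ : ℝ≥0) (xs : Fin 0 → X) : postKer k σ xs = k := by
  ext z z'
  simp [postKer]

lemma postMean_zero (m : X → ℝ) (k : X → X → ℝ) (σ : ℝ≥0) (xs : Fin 0 → X) (ys : Fin 0 → ℝ) :
    postMean m k σ xs ys = m := by
  ext z
  simp [postMean]

/-- Semidefiniteness of the earlier kernel serves only to make the pivot nonzero. It is a hypothesis
because `postKer_posSemidef` is itself proved by induction through this recursion. -/
lemma postKer_succ_of_posSemidef (hk : (Matrix.of k).PosSemidef) {σ : ℝ≥0} (hσ : 0 < σ) {n : ℕ}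
    (xs : Fin (n + 1) → X)
    (h : (Matrix.of (postKer k σ (fun i => xs (Fin.castSucc i)))).PosSemidef) :
    postKer k σ xs
      = stepKer (postKer k σ (fun i => xs (Fin.castSucc i))) σ (xs (Fin.last n)) := by
  have hs : postKer k σ (fun i => xs (Fin.castSucc i)) (xs (Fin.last n)) (xs (Fin.last n))
      + (σ : ℝ) ^ 2 ≠ 0 := by
    have := kernel_diag_nonneg h (xs (Fin.last n))
    positivity
  ext z z'
  change k z z' - krig k σ xs (fun i => k (xs i) z') z = _
  rw [krig_succ hk hσ xs _ z hs]
  have e : k (xs (Fin.last n)) z' - krig k σ (fun i => xs (Fin.castSucc i))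
      (fun i => k (xs (Fin.castSucc i)) z') (xs (Fin.last n))
      = postKer k σ (fun i => xs (Fin.castSucc i)) (xs (Fin.last n)) z' := rfl
  rw [e]
  simp only [stepKer]
  have e' : postKer k σ (fun i => xs (Fin.castSucc i)) z z' = k z z' -
    krig k σ (fun i => xs (Fin.castSucc i)) (fun i => k (xs (Fin.castSucc i)) z') z := rfl
  rw [e']; ring

variable [Fintype X]

/-- With v = k(x, ·)/s and A = I - v e_xᵀ, the updated kernel is A K Aᵀ + σ² v vᵀ, a sum of two
semidefinite matrices. -/
lemma stepKer_posSemidef (hk : (Matrix.of k).PosSemidef) {σ : ℝ≥0} (hσ : 0 < σ) (x : X) :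
    (Matrix.of (stepKer k σ x)).PosSemidef := by
  classical
  have hs : 0 < k x x + (σ : ℝ) ^ 2 := by
    have := kernel_diag_nonneg hk x
    positivity
  set s := k x x + (σ : ℝ) ^ 2 with hsdef
  set A : Matrix X X ℝ := 1 - Matrix.of (fun z w => k x z / s * (Pi.single x 1 : X → ℝ) w)
    with hA
  have h1 := hk.mul_mul_conjTranspose_same A
  have h2 : (((σ : ℝ) ^ 2) • Matrix.vecMulVec (fun z => k x z / s)
      (star (fun z => k x z / s))).PosSemidef :=
    (Matrix.posSemidef_vecMulVec_self_star _).smul (by positivity)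
  convert h1.add h2 using 1
  ext z z'
  have e1 : ∀ w, (A * Matrix.of k) z w = k z w - k x z / s * k x w := by
    intro w
    rw [hA, Matrix.sub_mul, Matrix.one_mul, Matrix.sub_apply]
    simp [Matrix.mul_apply, Pi.single_apply]
  have e2 : (A * Matrix.of k * Aᴴ) z z' = (A * Matrix.of k) z z'
      - (A * Matrix.of k) z x * (k x z' / s) := by
    have e3 : Aᴴ = 1 - Matrix.of (fun w z => k x z / s * (Pi.single x 1 : X → ℝ) w) := by
      ext i j
      simp [hA, Matrix.conjTranspose_apply, Matrix.one_apply, eq_comm]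
    rw [e3, Matrix.mul_sub, Matrix.mul_one, Matrix.sub_apply]
    generalize A * Matrix.of k = B
    simp [Matrix.mul_apply, Pi.single_apply]
  rw [Matrix.add_apply, e2, e1, e1]
  simp only [stepKer, Matrix.of_apply, Matrix.smul_apply, Matrix.vecMulVec_apply, smul_eq_mul,
    star_trivial, ← hsdef]
  rw [kernel_symm hk z x]
  field_simp
  rw [hsdef]; ring

lemma postKer_posSemidef (hk : (Matrix.of k).PosSemidef) {σ : ℝ≥0} (hσ : 0 < σ) {n : ℕ}
    (xs : Fin n → X) : (Matrix.of (postKer k σ xs)).PosSemidef := by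
  induction n with
  | zero => rwa [postKer_zero]
  | succ n ih =>
    rw [postKer_succ_of_posSemidef hk hσ xs (ih _)]
    exact stepKer_posSemidef (ih _) hσ _

lemma postKer_succ (hk : (Matrix.of k).PosSemidef) {σ : ℝ≥0} (hσ : 0 < σ) {n : ℕ}
    (xs : Fin (n + 1) → X) :
    postKer k σ xs
      = stepKer (postKer k σ (fun i => xs (Fin.castSucc i))) σ (xs (Fin.last n)) :=
  postKer_succ_of_posSemidef hk hσ xs (postKer_posSemidef hk hσ _)

lemma postKer_diag_nonneg (hk : (Matrix.of k).PosSemidef) {σ : ℝ≥0} (hσ : 0 < σ) {n : ℕ}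
    (xs : Fin n → X) (z : X) : 0 ≤ postKer k σ xs z z :=
  kernel_diag_nonneg (postKer_posSemidef hk hσ xs) z

lemma postKer_diag_add_pos (hk : (Matrix.of k).PosSemidef) {σ : ℝ≥0} (hσ : 0 < σ) {n : ℕ}
    (xs : Fin n → X) (z : X) : 0 < postKer k σ xs z z + (σ : ℝ) ^ 2 := by
  have := postKer_diag_nonneg hk hσ xs z
  positivity

lemma postMean_succ (m : X → ℝ) (hk : (Matrix.of k).PosSemidef) {σ : ℝ≥0} (hσ : 0 < σ) {n : ℕ}
    (xs : Fin (n + 1) → X) (ys : Fin (n + 1) → ℝ) :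
    postMean m k σ xs ys
      = stepMean (postMean m k σ (fun i => xs (Fin.castSucc i)) (fun i => ys (Fin.castSucc i)))
          (postKer k σ (fun i => xs (Fin.castSucc i))) σ (xs (Fin.last n)) (ys (Fin.last n)) := by
  ext z
  change m z + krig k σ xs (fun i => ys i - m (xs i)) z = _
  rw [krig_succ hk hσ xs _ z (postKer_diag_add_pos hk hσ _ _).ne']
  simp only [stepMean]
  have e : ∀ w, postMean m k σ (fun i => xs (Fin.castSucc i)) (fun i => ys (Fin.castSucc i)) w
    = m w + krig k σ (fun i => xs (Fin.castSucc i))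
      (fun i => ys (Fin.castSucc i) - m (xs (Fin.castSucc i))) w := fun _ => rfl
  rw [e, e]
  ring

/-- Conditioning never increases a variance: each update subtracts a square over a positive pivot.
With k(x, x) ≤ 1 this keeps every posterior variance at most 1. -/
lemma postKer_diag_le (hk : (Matrix.of k).PosSemidef) {σ : ℝ≥0} (hσ : 0 < σ) {n : ℕ}
    (xs : Fin n → X) (z : X) : postKer k σ xs z z ≤ k z z := by
  induction n with
  | zero => rw [postKer_zero]
  | succ n ih =>
    rw [postKer_succ hk hσ xs]
    refine le_trans ?_ (ih (fun i => xs (Fin.castSucc i)))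
    have := postKer_diag_add_pos hk hσ (fun i => xs (Fin.castSucc i)) (xs (Fin.last n))
    simp only [stepKer]
    have h2 := div_nonneg (mul_self_nonneg
      (postKer k σ (fun i => xs (Fin.castSucc i)) (xs (Fin.last n)) z)) this.le
    linarith

end LinearAlgebra

/-! ### Gaussian process laws and conditioning on one noisy observation. -/

section Gaussian

lemma measurable_stepMean {X : Type*} (m : X → ℝ) (k : X → X → ℝ) (σ : ℝ≥0) (x : X) :
    Measurable (stepMean m k σ x) := by
  refine measurable_pi_lambda _ fun z => ?_
  unfold stepMean
  fun_prop

variable {X : Type*} [Fintype X] [DecidableEq X]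

instance isProbabilityMeasure_gpLaw (m : X → ℝ) (k : X → X → ℝ) :
    IsProbabilityMeasure (gpLaw m k) :=
  Measure.isProbabilityMeasure_map (by fun_prop)

/-- Observed rewards enter a posterior only through its mean. As a translate of a fixed centred law,
the posterior depends measurably on them. -/
lemma gpLaw_eq_map_add (m : X → ℝ) (k : X → X → ℝ) :
    gpLaw m k = (gpLaw 0 k).map (fun g => m + g) := by
  unfold gpLaw multivariateGaussian
  rw [Measure.map_map (by fun_prop) (by fun_prop), Measure.map_map (by fun_prop) (by fun_prop),
    Measure.map_map (by fun_prop) (by fun_prop)]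
  congr 1
  ext g x
  simp

lemma lintegral_gpLaw_eq_add (m : X → ℝ) (k : X → X → ℝ) {F : (X → ℝ) → ℝ≥0∞}
    (hF : Measurable F) : ∫⁻ g, F g ∂(gpLaw m k) = ∫⁻ g, F (m + g) ∂(gpLaw 0 k) := by
  rw [gpLaw_eq_map_add, lintegral_map hF (by fun_prop)]

lemma map_eval_gpLaw (m : X → ℝ) {k : X → X → ℝ} (hk : (Matrix.of k).PosSemidef) (x : X) :
    (gpLaw m k).map (fun g => g x) = gaussianReal (m x) (k x x).toNNReal := by
  unfold gpLaw
  rw [Measure.map_map (by fun_prop) (by fun_prop)]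
  exact (measurePreserving_eval_multivariateGaussian hk).map_eq

lemma charFun_gpLaw (m : X → ℝ) {k : X → X → ℝ} (hk : (Matrix.of k).PosSemidef) (b : X → ℝ) :
    ∫ g, Complex.exp (((∑ x, b x * g x : ℝ) : ℂ) * Complex.I) ∂(gpLaw m k)
      = Complex.exp (((∑ x, b x * m x : ℝ) : ℂ) * Complex.I
          - ((∑ x, ∑ y, b x * k x y * b y : ℝ) : ℂ) / 2) := by
  unfold gpLaw
  rw [integral_map (by fun_prop) (Continuous.aestronglyMeasurable (by fun_prop))]
  have h := charFun_multivariateGaussian (μ := WithLp.toLp 2 m) hk (WithLp.toLp 2 b)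
  rw [charFun_apply] at h
  have e1 : ∀ g : EuclideanSpace ℝ X, inner ℝ g (WithLp.toLp 2 b) = ∑ x, b x * g x := by
    intro g; simp [PiLp.inner_apply]
  have e2 : inner ℝ (WithLp.toLp 2 b) (WithLp.toLp 2 m) = ∑ x, b x * m x := by
    simp [PiLp.inner_apply, mul_comm]
  have e3 : b ⬝ᵥ (Matrix.of k *ᵥ b) = ∑ x, ∑ y, b x * k x y * b y := by
    simp only [dotProduct, Matrix.mulVec, Matrix.of_apply, Finset.mul_sum, mul_assoc]
  simp only [e1, e2] at h
  rw [h]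
  congr 2
  rw [← e3]

lemma charFun_gaussianReal_apply (μ : ℝ) (v : ℝ≥0) (t : ℝ) :
    ∫ y, Complex.exp (((t * y : ℝ) : ℂ) * Complex.I) ∂(gaussianReal μ v)
      = Complex.exp (((t * μ : ℝ) : ℂ) * Complex.I - ((v * t ^ 2 : ℝ) : ℂ) / 2) := by
  have := charFun_gaussianReal (μ := μ) (v := v) t
  rw [charFun_apply_real] at this
  simpa using this

/-- Bayes' rule for one noisy observation of a Gaussian process: the joint law of the observation
and the process is recovered from the predictive law and the updated process. -/
lemma gpLaw_bayes (m : X → ℝ) {k : X → X → ℝ} (hk : (Matrix.of k).PosSemidef) {σ : ℝ≥0}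
    (hσ : 0 < σ) (x : X) :
    ((gpLaw m k).prod (gaussianReal 0 (σ ^ 2))).map (fun z => (z.1 x + z.2, z.1))
      = ((gaussianReal (m x) (Real.toNNReal (k x x + (σ : ℝ) ^ 2))).prod
          (gpLaw 0 (stepKer k σ x))).map (fun z => (z.1, stepMean m k σ x z.1 + z.2)) := by
  have hm := measurable_stepMean m k σ x
  have hk' := stepKer_posSemidef hk hσ x
  have hs : 0 < k x x + (σ : ℝ) ^ 2 := by
    have := kernel_diag_nonneg hk x
    positivity
  have := Measure.isProbabilityMeasure_map (μ := (gpLaw m k).prod (gaussianReal 0 (σ ^ 2)))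
    (f := fun z => (z.1 x + z.2, z.1)) (by fun_prop)
  have := Measure.isProbabilityMeasure_map (μ := (gaussianReal (m x)
    (Real.toNNReal (k x x + (σ : ℝ) ^ 2))).prod (gpLaw 0 (stepKer k σ x)))
    (f := fun z => (z.1, stepMean m k σ x z.1 + z.2)) (by fun_prop)
  -- Both sides are images of product laws, so it suffices to compare characteristic functions at a
  -- general functional (y, g) ↦ a y + ∑ b g.
  apply Measure.ext_of_charFunDual
  ext L
  set a : ℝ := L (1, 0) with ha
  set b : X → ℝ := fun z => L (0, Pi.single z 1) with hb
  have hL : ∀ (y : ℝ) (g : X → ℝ), L (y, g) = a * y + ∑ z, b z * g z := by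
    intro y g
    have e : (y, g) = y • ((1 : ℝ), (0 : X → ℝ)) + ∑ z, g z • ((0 : ℝ), (Pi.single z 1 : X → ℝ)) := by
      ext w
      · simp [Prod.fst_sum]
      · simp [Prod.snd_sum, Finset.sum_apply, Pi.single_apply]
    rw [e, map_add, map_smul, map_sum]
    simp only [map_smul]
    simp [ha, hb, mul_comm]
  rw [charFunDual_apply, charFunDual_apply, integral_map (by fun_prop) (by fun_prop),
    integral_map (by fun_prop) (by fun_prop)]
  simp only [hL]
  set s := k x x + (σ : ℝ) ^ 2 with hsdef
  set u : ℝ := ∑ z, b z * k x z with hu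
  have hsym : ∀ z, k z x = k x z := fun z => kernel_symm hk z x
  have l1 : ∀ z : (X → ℝ) × ℝ,
      Complex.exp (((a * (z.1 x + z.2) + ∑ w, b w * z.1 w : ℝ) : ℂ) * Complex.I)
      = Complex.exp (((∑ w, (b w + a * (Pi.single x 1 : X → ℝ) w) * z.1 w : ℝ) : ℂ) * Complex.I)
        * Complex.exp (((a * z.2 : ℝ) : ℂ) * Complex.I) := by
    intro z
    rw [← Complex.exp_add, ← add_mul, ← Complex.ofReal_add]
    congr 3
    simp only [add_mul, Finset.sum_add_distrib]
    simp [Pi.single_apply]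
    ring
  -- The updated mean is affine in the observation, so its slope u/s joins the frequency a, and the
  -- integrand factors into a function of the observation times a function of the centred process.
  have l2 : ∀ z : ℝ × (X → ℝ),
      Complex.exp (((a * z.1 + ∑ w, b w * (stepMean m k σ x z.1 + z.2) w : ℝ) : ℂ) * Complex.I)
      = Complex.exp (((∑ w, b w * m w - m x * u / s : ℝ) : ℂ) * Complex.I)
        * (Complex.exp ((((a + u / s) * z.1 : ℝ) : ℂ) * Complex.I)
        * Complex.exp (((∑ w, b w * z.2 w : ℝ) : ℂ) * Complex.I)) := by
    intro z
    rw [← Complex.exp_add, ← Complex.exp_add, ← add_mul, ← add_mul, ← Complex.ofReal_add,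
      ← Complex.ofReal_add]
    congr 3
    have : ∀ w, b w * (stepMean m k σ x z.1 + z.2) w
        = b w * m w + (z.1 - m x) / s * (b w * k x w) + b w * z.2 w := by
      intro w
      simp only [Pi.add_apply, stepMean, ← hsdef]
      ring
    simp only [this, Finset.sum_add_distrib, ← Finset.mul_sum, ← hu]
    ring
  simp only [l1, l2]
  rw [integral_const_mul, integral_prod_mul
    (f := fun g : X → ℝ => Complex.exp (((∑ w, (b w + a * (Pi.single x 1 : X → ℝ) w) * g w : ℝ) : ℂ)
      * Complex.I)) (g := fun e : ℝ => Complex.exp (((a * e : ℝ) : ℂ) * Complex.I)),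
    integral_prod_mul (f := fun e : ℝ => Complex.exp ((((a + u / s) * e : ℝ) : ℂ) * Complex.I))
      (g := fun g : X → ℝ => Complex.exp (((∑ w, b w * g w : ℝ) : ℂ) * Complex.I)),
    charFun_gpLaw _ hk, charFun_gpLaw _ hk', charFun_gaussianReal_apply,
    charFun_gaussianReal_apply]
  simp only [← Complex.exp_add]
  congr 1
  have q1 : ∑ z, ∑ w, (b z + a * (Pi.single x 1 : X → ℝ) z) * k z w
      * (b w + a * (Pi.single x 1 : X → ℝ) w)
      = ∑ z, ∑ w, b z * k z w * b w + 2 * a * u + a ^ 2 * k x x := by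
    simp only [add_mul, mul_add, Finset.sum_add_distrib]
    simp [Pi.single_apply, hsym]
    have : ∑ w, a * k x w * b w = a * u := by
      rw [hu, Finset.mul_sum]; exact Finset.sum_congr rfl fun _ _ => by ring
    have h2 : ∑ z, b z * k x z * a = a * u := by
      rw [hu, Finset.mul_sum]; exact Finset.sum_congr rfl fun _ _ => by ring
    rw [this, ← Finset.sum_mul, ← hu]
    ring
  have q2 : ∑ z, ∑ w, b z * stepKer k σ x z w * b w
      = ∑ z, ∑ w, b z * k z w * b w - u ^ 2 / s := by
    have : ∀ z w, b z * stepKer k σ x z w * b w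
        = b z * k z w * b w - (b z * k x z) * (b w * k x w) / s := by
      intro z w
      simp only [stepKer, ← hsdef]
      ring
    simp only [this, Finset.sum_sub_distrib]
    rw [sq, hu, Finset.sum_mul_sum, Finset.sum_div]
    simp only [Finset.sum_div]
  have q3 : ∑ z, (b z + a * (Pi.single x 1 : X → ℝ) z) * m z = ∑ z, b z * m z + a * m x := by
    simp only [add_mul, Finset.sum_add_distrib]
    simp [Pi.single_apply]
  -- The quadratic parts agree by completing the square: s (a + u/s)² = s a² + 2 a u + u²/s, and the
  -- update of the kernel removes exactly u²/s.
  rw [q1, q2, q3, Real.coe_toNNReal _ hs.le]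
  have hs' : (s : ℂ) ≠ 0 := by exact_mod_cast hs.ne'
  have hsC : (s : ℂ) = k x x + (σ : ℂ) ^ 2 := by rw [hsdef]; push_cast; rfl
  have hkx : (k x x : ℂ) = s - (σ : ℂ) ^ 2 := by rw [hsC]; ring
  push_cast
  simp only [Pi.zero_apply, Complex.ofReal_zero, mul_zero, Finset.sum_const_zero]
  rw [hkx]
  field_simp
  ring

/-- The lintegral form of Bayes' rule for one observation. -/
lemma lintegral_gpLaw_bayes (m : X → ℝ) {k : X → X → ℝ} (hk : (Matrix.of k).PosSemidef) {σ : ℝ≥0}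
    (hσ : 0 < σ) (x : X) {F : ℝ → (X → ℝ) → ℝ≥0∞} (hF : Measurable (Function.uncurry F)) :
    ∫⁻ g, ∫⁻ e, F (g x + e) g ∂(gaussianReal 0 (σ ^ 2)) ∂(gpLaw m k)
      = ∫⁻ y, gaussianPDF (m x) (Real.toNNReal (k x x + (σ : ℝ) ^ 2)) y
          * ∫⁻ g, F y g ∂(gpLaw (stepMean m k σ x y) (stepKer k σ x)) := by
  have hm := measurable_stepMean m k σ x
  have hs : 0 < k x x + (σ : ℝ) ^ 2 := by
    have := kernel_diag_nonneg hk x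
    positivity
  have h1 : ∫⁻ g, ∫⁻ e, F (g x + e) g ∂(gaussianReal 0 (σ ^ 2)) ∂(gpLaw m k)
      = ∫⁻ z, Function.uncurry F z
        ∂(((gpLaw m k).prod (gaussianReal 0 (σ ^ 2))).map (fun z => (z.1 x + z.2, z.1))) := by
    rw [lintegral_map hF (by fun_prop), lintegral_prod _ (by fun_prop)]
    rfl
  have h2 : Measurable (fun y => ∫⁻ g, Function.uncurry F (y, stepMean m k σ x y + g)
      ∂(gpLaw 0 (stepKer k σ x))) :=
    Measurable.lintegral_prod_right'
      (f := fun z : ℝ × (X → ℝ) => Function.uncurry F (z.1, stepMean m k σ x z.1 + z.2))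
      (by fun_prop)
  rw [h1, gpLaw_bayes m hk hσ, lintegral_map hF (by fun_prop), lintegral_prod _ (by fun_prop),
    gaussianReal_of_var_ne_zero _ (by simpa using hs),
    lintegral_withDensity_eq_lintegral_mul _ (measurable_gaussianPDF _ _) h2]
  refine lintegral_congr fun y => ?_
  simp only [Pi.mul_apply]
  rw [lintegral_gpLaw_eq_add (stepMean m k σ x y) _ (by fun_prop)]
  rfl

end Gaussian

/-! ### Histories and their extension by one round. -/

/-- A history of `n` rounds: the arms played and the rewards observed. -/
abbrev Hist (X : Type*) (n : ℕ) : Type _ := (Fin n → X) × (Fin n → ℝ)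

/-- The history `h` followed by a round in which `x` is played and `y` is observed. -/
def Hist.snoc {X : Type*} {n : ℕ} (h : Hist X n) (x : X) (y : ℝ) : Hist X (n + 1) :=
  (Fin.snoc (α := fun _ => X) h.1 x, Fin.snoc (α := fun _ => ℝ) h.2 y)

lemma measurable_fin_snoc {α β : Type*} [MeasurableSpace α] [MeasurableSpace β] {n : ℕ}
    {f : α → Fin n → β} {g : α → β} (hf : Measurable f) (hg : Measurable g) :
    Measurable fun a => (Fin.snoc (α := fun _ => β) (f a) (g a) : Fin (n + 1) → β) := by
  refine measurable_pi_lambda _ fun i => ?_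
  refine Fin.lastCases ?_ (fun i => ?_) i
  · simpa using hg
  · simpa using measurable_pi_iff.1 hf i

lemma Hist.measurable_snoc {α X : Type*} [MeasurableSpace α] [MeasurableSpace X] {n : ℕ}
    {h : α → Hist X n} {x : α → X} {y : α → ℝ} (hh : Measurable h) (hx : Measurable x)
    (hy : Measurable y) : Measurable fun a => (h a).snoc (x a) (y a) :=
  (measurable_fin_snoc hh.fst hx).prodMk (measurable_fin_snoc hh.snd hy)

/-! ### The hyperposterior as a Markov kernel, and Bayes' rule for the mixture. -/

section Kernels

variable {X P : Type*} [Fintype X] [MeasurableSpace X] [MeasurableSingletonClass X]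

lemma measurable_eval_uncurry : Measurable fun z : (X → ℝ) × X => z.1 z.2 :=
  measurable_from_prod_countable_left fun x => measurable_pi_apply x

omit [Fintype X] [MeasurableSpace X] [MeasurableSingletonClass X] in
lemma measurable_postMean_right (m : X → ℝ) (k : X → X → ℝ) (σ : ℝ≥0) {n : ℕ} (xs : Fin n → X) :
    Measurable fun ys : Fin n → ℝ => postMean m k σ xs ys := by
  refine measurable_pi_lambda _ fun x => ?_
  unfold postMean
  simp only [dotProduct, Matrix.mulVec]
  fun_prop

/-- There are finitely many arm sequences, so joint measurability reduces to fixed arms, where the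
posterior mean is affine in the rewards. -/
lemma measurable_postMean (m : X → ℝ) (k : X → X → ℝ) (σ : ℝ≥0) (n : ℕ) :
    Measurable fun h : Hist X n => postMean m k σ h.1 h.2 :=
  measurable_from_prod_countable_right fun xs => measurable_postMean_right m k σ xs

variable [DecidableEq X]

/-- The posterior Gaussian process as a Markov kernel from histories. -/
def gpPostKernel (m : X → ℝ) (k : X → X → ℝ) (σ : ℝ≥0) (n : ℕ) :
    Kernel (Hist X n) (X → ℝ) where
  toFun h := gpLaw (postMean m k σ h.1 h.2) (postKer k σ h.1)
  measurable' := by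
    refine measurable_from_prod_countable_right fun xs => ?_
    refine Measure.measurable_of_measurable_coe _ fun B hB => ?_
    have hm := measurable_postMean_right m k σ xs
    have : ∀ ys, gpLaw (postMean m k σ xs ys) (postKer k σ xs) B
        = gpLaw 0 (postKer k σ xs) (Prod.mk ys ⁻¹'
          ((fun z : (Fin n → ℝ) × (X → ℝ) => postMean m k σ xs z.1 + z.2) ⁻¹' B)) := by
      intro ys
      rw [gpLaw_eq_map_add, Measure.map_apply (by fun_prop) hB]
      rfl
    simp only [this]
    exact measurable_measure_prodMk_left (hB.preimage (by fun_prop))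

lemma gpPostKernel_apply (m : X → ℝ) (k : X → X → ℝ) (σ : ℝ≥0) (n : ℕ) (h : Hist X n) :
    gpPostKernel m k σ n h = gpLaw (postMean m k σ h.1 h.2) (postKer k σ h.1) := rfl

instance (m : X → ℝ) (k : X → X → ℝ) (σ : ℝ≥0) (n : ℕ) :
    IsMarkovKernel (gpPostKernel m k σ n) :=
  ⟨fun h => by rw [gpPostKernel_apply]; infer_instance⟩

variable [Fintype P]

section HyperPost

omit [Fintype X] [DecidableEq X] [MeasurableSpace X] [MeasurableSingletonClass X]

variable (P₁ : PMF P) (m : P → X → ℝ) (k : P → X → X → ℝ) (σ : ℝ≥0)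

/-- The predictive density of `q` at the observation `y` of the arm `x`. -/
def predPDF (n : ℕ) (h : Hist X n) (x : X) (y : ℝ) (q : P) : ℝ :=
  gaussianPDFReal (postMean (m q) (k q) σ h.1 h.2 x)
    (Real.toNNReal (postKer (k q) σ h.1 x x + (σ : ℝ) ^ 2)) y

/-- The predictive density of the mixture over the hyperposterior. -/
def mixPDF (n : ℕ) (h : Hist X n) (x : X) (y : ℝ) : ℝ :=
  ∑ q, predPDF m k σ n h x y q * hyperPost P₁ m k σ n h.1 h.2 q

lemma hyperPost_snoc (n : ℕ) (h : Hist X n) (x : X) (y : ℝ) (p : P) :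
    hyperPost P₁ m k σ (n + 1) (h.snoc x y).1 (h.snoc x y).2 p
      = predPDF m k σ n h x y p * hyperPost P₁ m k σ n h.1 h.2 p / mixPDF P₁ m k σ n h x y := by
  simp [hyperPost, Hist.snoc, mixPDF, predPDF]

lemma Hist.eq_snoc {n : ℕ} (h : Hist X (n + 1)) :
    h = Hist.snoc (fun i => h.1 (Fin.castSucc i), fun i => h.2 (Fin.castSucc i))
      (h.1 (Fin.last n)) (h.2 (Fin.last n)) := by
  refine Prod.ext ?_ ?_
  · exact (Fin.snoc_init_self h.1).symm
  · exact (Fin.snoc_init_self h.2).symm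

lemma hyperPost_nonneg (n : ℕ) (h : Hist X n) (p : P) :
    0 ≤ hyperPost P₁ m k σ n h.1 h.2 p := by
  induction n generalizing p with
  | zero => exact ENNReal.toReal_nonneg
  | succ n ih =>
    rw [h.eq_snoc, hyperPost_snoc]
    exact div_nonneg (mul_nonneg (gaussianPDFReal_nonneg _ _ _) (ih _ _))
      (Finset.sum_nonneg fun q _ => mul_nonneg (gaussianPDFReal_nonneg _ _ _) (ih _ _))

lemma sum_toReal_pmf (P₁ : PMF P) : ∑ p, (P₁ p).toReal = 1 := by
  have h := P₁.tsum_coe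
  rw [tsum_fintype] at h
  rw [← ENNReal.toReal_sum fun p _ => P₁.apply_ne_top p, h, ENNReal.toReal_one]

end HyperPost

variable (P₁ : PMF P) (m : P → X → ℝ) {k : P → X → X → ℝ} (hk : ∀ p, (Matrix.of (k p)).PosSemidef)
  {σ : ℝ≥0} (hσ : 0 < σ)

omit [Fintype P] in
include hk hσ in
omit [MeasurableSpace X] [MeasurableSingletonClass X] [DecidableEq X] in
lemma predPDF_pos (n : ℕ) (h : Hist X n) (x : X) (y : ℝ) (q : P) : 0 < predPDF m k σ n h x y q :=
  gaussianPDFReal_pos _ _ _ (by simpa using postKer_diag_add_pos (hk q) hσ h.1 x)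

-- Some hyperposterior weight is positive and all predictive densities are. The normalisation at
-- stage `n` is assumed because `hyperPost_sum` uses this positivity to reach stage `n + 1`; thus no
-- update divides by zero.
include hk hσ in
omit [MeasurableSpace X] [MeasurableSingletonClass X] [DecidableEq X] in
lemma mixPDF_pos_of_sum (n : ℕ) (h : Hist X n) (x : X) (y : ℝ)
    (hs : ∑ p, hyperPost P₁ m k σ n h.1 h.2 p = 1) : 0 < mixPDF P₁ m k σ n h x y := by
  obtain ⟨q, -, hq⟩ : ∃ q ∈ Finset.univ, 0 < hyperPost P₁ m k σ n h.1 h.2 q := by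
    apply Finset.exists_lt_of_sum_lt (f := fun _ => (0 : ℝ))
    simp [hs]
  exact Finset.sum_pos' (fun q _ => mul_nonneg (predPDF_pos m hk hσ n h x y q).le
    (hyperPost_nonneg P₁ m k σ n h q)) ⟨q, Finset.mem_univ _,
      mul_pos (predPDF_pos m hk hσ n h x y q) hq⟩

include hk hσ in
omit [MeasurableSpace X] [MeasurableSingletonClass X] [DecidableEq X] in
lemma hyperPost_sum (n : ℕ) (h : Hist X n) : ∑ p, hyperPost P₁ m k σ n h.1 h.2 p = 1 := by
  induction n with
  | zero => exact sum_toReal_pmf P₁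
  | succ n ih =>
    rw [h.eq_snoc]
    simp only [hyperPost_snoc]
    rw [← Finset.sum_div]
    exact div_self (mixPDF_pos_of_sum P₁ m hk hσ n _ _ _ (ih _)).ne'

include hk hσ in
omit [MeasurableSpace X] [MeasurableSingletonClass X] [DecidableEq X] in
lemma mixPDF_pos (n : ℕ) (h : Hist X n) (x : X) (y : ℝ) : 0 < mixPDF P₁ m k σ n h x y :=
  mixPDF_pos_of_sum P₁ m hk hσ n h x y (hyperPost_sum P₁ m hk hσ n h)

omit [Fintype X] [DecidableEq X] [MeasurableSingletonClass X] [MeasurableSpace X] in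
lemma measurable_hyperPost_right (k : P → X → X → ℝ) (σ : ℝ≥0) (n : ℕ) (xs : Fin n → X) (p : P) :
    Measurable fun ys : Fin n → ℝ => hyperPost P₁ m k σ n xs ys p := by
  induction n generalizing p with
  | zero => exact measurable_const
  | succ n ih =>
    simp only [hyperPost]
    have hc : Measurable fun (ys : Fin (n + 1) → ℝ) (i : Fin n) => ys (Fin.castSucc i) := by
      fun_prop
    have hw : ∀ q, Measurable fun ys : Fin (n + 1) → ℝ =>
        gaussianPDFReal (postMean (m q) (k q) σ (fun i => xs (Fin.castSucc i))
          (fun i => ys (Fin.castSucc i)) (xs (Fin.last n)))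
        (Real.toNNReal (postKer (k q) σ (fun i => xs (Fin.castSucc i)) (xs (Fin.last n))
          (xs (Fin.last n)) + (σ : ℝ) ^ 2)) (ys (Fin.last n))
        * hyperPost P₁ m k σ n (fun i => xs (Fin.castSucc i)) (fun i => ys (Fin.castSucc i)) q := by
      intro q
      refine Measurable.mul ?_ ((ih _ q).comp hc)
      have h1 := (measurable_pi_iff.1 (measurable_postMean_right (m q) (k q) σ
        (fun i => xs (Fin.castSucc i))) (xs (Fin.last n))).comp hc
      exact measurable_uncurry_gaussianPDFReal.comp
        (h1.prodMk (measurable_const.prodMk (measurable_pi_apply (Fin.last n))))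
    exact (hw p).div (Finset.measurable_sum _ fun q _ => hw q)

omit [DecidableEq X] in
lemma measurable_hyperPost (k : P → X → X → ℝ) (σ : ℝ≥0) (n : ℕ) (p : P) :
    Measurable fun h : Hist X n => hyperPost P₁ m k σ n h.1 h.2 p :=
  measurable_from_prod_countable_right fun xs => measurable_hyperPost_right P₁ m k σ n xs p

variable [MeasurableSpace P]

/-- The joint law of the prior and the reward function under the hyperposterior, as a kernel from
histories. -/
def hyperKernel (P₁ : PMF P) (m : P → X → ℝ) (k : P → X → X → ℝ) (σ : ℝ≥0) (n : ℕ) :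
    Kernel (Hist X n) (P × (X → ℝ)) where
  toFun h := ∑ p, ENNReal.ofReal (hyperPost P₁ m k σ n h.1 h.2 p) •
    (gpPostKernel (m p) (k p) σ n h).map (Prod.mk p)
  measurable' := by
    refine Measure.measurable_of_measurable_coe _ fun B hB => ?_
    simp only [Measure.finsetSum_apply, Measure.smul_apply, smul_eq_mul]
    refine Finset.measurable_sum _ fun p _ => ?_
    refine (measurable_hyperPost P₁ m k σ n p).ennreal_ofReal.mul ?_
    simp only [Measure.map_apply measurable_prodMk_left hB]
    exact Kernel.measurable_coe _ (measurable_prodMk_left hB)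

lemma hyperKernel_apply (P₁ : PMF P) (m : P → X → ℝ) (k : P → X → X → ℝ) (σ : ℝ≥0) (n : ℕ)
    (h : Hist X n) : hyperKernel P₁ m k σ n h
      = ∑ p, ENNReal.ofReal (hyperPost P₁ m k σ n h.1 h.2 p) •
        (gpPostKernel (m p) (k p) σ n h).map (Prod.mk p) := rfl

lemma lintegral_hyperKernel (P₁ : PMF P) (m : P → X → ℝ) (k : P → X → X → ℝ) (σ : ℝ≥0) (n : ℕ)
    (h : Hist X n) {F : P × (X → ℝ) → ℝ≥0∞} (hF : Measurable F) :
    ∫⁻ z, F z ∂(hyperKernel P₁ m k σ n h)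
      = ∑ p, ENNReal.ofReal (hyperPost P₁ m k σ n h.1 h.2 p)
        * ∫⁻ g, F (p, g) ∂(gpLaw (postMean (m p) (k p) σ h.1 h.2) (postKer (k p) σ h.1)) := by
  rw [hyperKernel_apply, lintegral_finsetSum_measure]
  refine Finset.sum_congr rfl fun p _ => ?_
  rw [lintegral_smul_measure, lintegral_map hF measurable_prodMk_left, smul_eq_mul]
  rfl

include hk hσ in
lemma isMarkovKernel_hyperKernel (n : ℕ) : IsMarkovKernel (hyperKernel P₁ m k σ n) := by
  refine ⟨fun h => ⟨?_⟩⟩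
  have := lintegral_hyperKernel P₁ m k σ n h (F := fun _ => 1) measurable_const
  simp only [lintegral_const, measure_univ, mul_one, one_mul] at this
  rw [this, ← ENNReal.ofReal_sum_of_nonneg fun p _ => hyperPost_nonneg P₁ m k σ n h p,
    hyperPost_sum P₁ m hk hσ, ENNReal.ofReal_one]

include hk hσ in
/-- Bayes' rule under the hyperposterior: observing the arm `x` turns the hyperposterior into the
mixture of the updated hyperposteriors. -/
lemma lintegral_hyperKernel_bayes (n : ℕ) (h : Hist X n) (x : X)
    {F : ℝ → P × (X → ℝ) → ℝ≥0∞} (hF : Measurable (Function.uncurry F)) :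
    ∫⁻ z, ∫⁻ e, F (z.2 x + e) z ∂(gaussianReal 0 (σ ^ 2)) ∂(hyperKernel P₁ m k σ n h)
      = ∫⁻ y, ENNReal.ofReal (mixPDF P₁ m k σ n h x y)
        * ∫⁻ z, F y z ∂(hyperKernel P₁ m k σ (n + 1) (h.snoc x y)) := by
  have hFp : ∀ p, Measurable (Function.uncurry fun (y : ℝ) (g : X → ℝ) => F y (p, g)) := fun p =>
    hF.comp (measurable_fst.prodMk (measurable_const.prodMk measurable_snd))
  have hin : ∀ p, Measurable fun y : ℝ =>
      gaussianPDF (postMean (m p) (k p) σ h.1 h.2 x)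
        (Real.toNNReal (postKer (k p) σ h.1 x x + (σ : ℝ) ^ 2)) y
      * ∫⁻ g, F y (p, g) ∂(gpLaw (stepMean (postMean (m p) (k p) σ h.1 h.2)
        (postKer (k p) σ h.1) σ x y) (stepKer (postKer (k p) σ h.1) σ x)) := by
    intro p
    refine (measurable_gaussianPDF _ _).mul ?_
    have h0 : ∀ y : ℝ, ∫⁻ g, F y (p, g) ∂(gpLaw (stepMean (postMean (m p) (k p) σ h.1 h.2)
        (postKer (k p) σ h.1) σ x y) (stepKer (postKer (k p) σ h.1) σ x))
        = ∫⁻ g, F y (p, stepMean (postMean (m p) (k p) σ h.1 h.2) (postKer (k p) σ h.1) σ x y + g)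
          ∂(gpLaw 0 (stepKer (postKer (k p) σ h.1) σ x)) := fun y =>
      lintegral_gpLaw_eq_add _ _ ((hFp p).comp measurable_prodMk_left)
    simp only [h0]
    have hm := measurable_stepMean (postMean (m p) (k p) σ h.1 h.2) (postKer (k p) σ h.1) σ x
    exact Measurable.lintegral_prod_right' (f := fun z : ℝ × (X → ℝ) => F z.1 (p,
      stepMean (postMean (m p) (k p) σ h.1 h.2) (postKer (k p) σ h.1) σ x z.1 + z.2))
      ((hFp p).comp (f := fun z : ℝ × (X → ℝ) => (z.1,
        stepMean (postMean (m p) (k p) σ h.1 h.2) (postKer (k p) σ h.1) σ x z.1 + z.2))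
        (by fun_prop))
  have hG : Measurable fun z : P × (X → ℝ) => ∫⁻ e, F (z.2 x + e) z ∂(gaussianReal 0 (σ ^ 2)) :=
    Measurable.lintegral_prod_right' (f := fun w : (P × (X → ℝ)) × ℝ => F (w.1.2 x + w.2) w.1)
      (hF.comp (f := fun w : (P × (X → ℝ)) × ℝ => (w.1.2 x + w.2, w.1)) (by fun_prop))
  rw [lintegral_hyperKernel P₁ m k σ n h hG]
  have e1 : ∀ p, ∫⁻ g, ∫⁻ e, F (g x + e) (p, g) ∂(gaussianReal 0 (σ ^ 2))
      ∂(gpLaw (postMean (m p) (k p) σ h.1 h.2) (postKer (k p) σ h.1)) = _ := fun p =>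
    lintegral_gpLaw_bayes (postMean (m p) (k p) σ h.1 h.2)
      (postKer_posSemidef (hk p) hσ h.1) hσ x (hFp p)
  simp only [e1]
  have e2 := fun p => lintegral_const_mul (μ := volume)
    (ENNReal.ofReal (hyperPost P₁ m k σ n h.1 h.2 p)) (hin p)
  simp only [← e2]
  rw [← lintegral_finsetSum _ fun p _ => (hin p).const_mul _]
  refine lintegral_congr fun y => ?_
  rw [lintegral_hyperKernel P₁ m k σ (n + 1) _ (F := F y) (hF.comp measurable_prodMk_left),
    Finset.mul_sum]
  refine Finset.sum_congr rfl fun p _ => ?_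
  have hW := mixPDF_pos P₁ m hk hσ n h x y
  rw [← mul_assoc, ← mul_assoc]
  congr 1
  -- The normaliser of the update cancels the mixture density, leaving the old weight times the
  -- predictive density of `p`.
  · rw [hyperPost_snoc, ← ENNReal.ofReal_mul hW.le, mul_div_cancel₀ _ hW.ne', mul_comm,
      ENNReal.ofReal_mul (predPDF_pos m hk hσ n h x y p).le]
    rfl
  · rw [postMean_succ (m p) (hk p) hσ, postKer_succ (hk p) hσ]
    simp [Hist.snoc]

include hk hσ in
/-- Averaging over the hyperposterior after one more observation does not change expectations. -/
lemma lintegral_hyperKernel_tower (n : ℕ) (h : Hist X n) (x : X)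
    {F : ℝ → P × (X → ℝ) → ℝ≥0∞} (hF : Measurable (Function.uncurry F)) :
    ∫⁻ z, ∫⁻ e, F (z.2 x + e) z ∂(gaussianReal 0 (σ ^ 2)) ∂(hyperKernel P₁ m k σ n h)
      = ∫⁻ z, ∫⁻ e, ∫⁻ w, F (z.2 x + e) w ∂(hyperKernel P₁ m k σ (n + 1) (h.snoc x (z.2 x + e)))
          ∂(gaussianReal 0 (σ ^ 2)) ∂(hyperKernel P₁ m k σ n h) := by
  have := isMarkovKernel_hyperKernel P₁ m hk hσ (n + 1)
  have hs : Measurable fun y : ℝ => h.snoc x y :=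
    Hist.measurable_snoc measurable_const measurable_const measurable_id
  have hG : Measurable fun y : ℝ => ∫⁻ w, F y w ∂(hyperKernel P₁ m k σ (n + 1) (h.snoc x y)) :=
    Measurable.lintegral_kernel_prod_right' (κ := (hyperKernel P₁ m k σ (n + 1)).comap _ hs) hF
  -- Bayes' rule is applied to `F` and to its posterior average. The latter no longer depends on the
  -- truth, and the kernel has mass 1, so both sides become the same integral over `y`.
  rw [lintegral_hyperKernel_bayes P₁ m hk hσ n h x hF,
    lintegral_hyperKernel_bayes P₁ m hk hσ n h x
      (F := fun y _ => ∫⁻ w, F y w ∂(hyperKernel P₁ m k σ (n + 1) (h.snoc x y)))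
      (hG.comp measurable_fst)]
  simp

end Kernels

/-! ### Conditional laws along a run. -/

section RunLaws

/-- The values of `pastBefore`. -/
abbrev Past (P X : Type*) (t : ℕ) : Type _ :=
  (P × (X → ℝ)) × (Fin t → P × (X → ℝ) × ℝ)

/-- The history that is visible in the past. -/
def histOf {P X : Type*} (am : (X → ℝ) → X) (t : ℕ) (w : Past P X t) : Hist X t :=
  (fun i => am (w.2 i).2.1, fun i => w.1.2 (am (w.2 i).2.1) + (w.2 i).2.2)

/-- The history of a run before round `t`. -/
def runHist {Ω X : Type*} (am : (X → ℝ) → X) (f : Ω → X → ℝ) (ft : ℕ → Ω → X → ℝ)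
    (ε : ℕ → Ω → ℝ) (t : ℕ) (ω : Ω) : Hist X t :=
  (armsBefore am ft t ω, rewardsBefore am f ft ε t ω)

lemma runHist_succ {Ω X : Type*} (am : (X → ℝ) → X) (f : Ω → X → ℝ) (ft : ℕ → Ω → X → ℝ)
    (ε : ℕ → Ω → ℝ) (t : ℕ) (ω : Ω) :
    runHist am f ft ε (t + 1) ω
      = (runHist am f ft ε t ω).snoc (am (ft t ω)) (f ω (am (ft t ω)) + ε t ω) :=
  Hist.eq_snoc _

variable {Ω X P : Type*} [MeasurableSpace Ω] [Fintype X] [DecidableEq X] [MeasurableSpace X]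
  [MeasurableSingletonClass X] [Fintype P] [MeasurableSpace P] [MeasurableSingletonClass P]
  {P₁ : PMF P} {m : P → X → ℝ} {k : P → X → X → ℝ} {σ : ℝ≥0} {am : (X → ℝ) → X} {T : ℕ}
  {μ : Measure Ω} {pstar : Ω → P} {f : Ω → X → ℝ} {pt : ℕ → Ω → P} {ft : ℕ → Ω → X → ℝ}
  {ε : ℕ → Ω → ℝ}

omit [DecidableEq X] [Fintype P] [MeasurableSingletonClass P] in
lemma measurable_histOf (ham : Measurable am) (t : ℕ) :
    Measurable (histOf (P := P) am t) := by
  have h1 : ∀ i : Fin t, Measurable fun w : Past P X t => am (w.2 i).2.1 := fun i =>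
    ham.comp (by fun_prop)
  refine Measurable.prodMk (measurable_pi_lambda _ h1) (measurable_pi_lambda _ fun i => ?_)
  exact (measurable_eval_uncurry.comp
    (f := fun w : Past P X t => (w.1.2, am (w.2 i).2.1))
    (Measurable.prodMk (by fun_prop) (h1 i))).add (by fun_prop)

omit [MeasurableSpace X] [MeasurableSingletonClass X] [MeasurableSingletonClass P] in
lemma IsRun.measurable_pastBefore (hrun : IsRun P₁ m k σ am T μ pstar f pt ft ε) {t : ℕ}
    (ht : t ≤ T) : Measurable (pastBefore pstar f pt ft ε t) := by
  refine (hrun.measurable_pstar.prodMk hrun.measurable_f).prodMk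
    (measurable_pi_lambda _ fun i => ?_)
  have hi : (i : ℕ) < T := i.2.trans_le ht
  exact (hrun.measurable_pt i hi).prodMk ((hrun.measurable_ft i hi).prodMk
    (hrun.measurable_noise i hi))

omit [MeasurableSingletonClass P] in
lemma IsRun.measurable_runHist (hrun : IsRun P₁ m k σ am T μ pstar f pt ft ε)
    (ham : Measurable am) {t : ℕ} (ht : t ≤ T) : Measurable (runHist am f ft ε t) :=
  (measurable_histOf ham t).comp (hrun.measurable_pastBefore ht)

/-- The conditional expectation in `law_sample`, integrated over an event of the past and rewritten
with extended nonnegative reals. -/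
lemma IsRun.measure_sample [IsProbabilityMeasure μ]
    (hrun : IsRun P₁ m k σ am T μ pstar f pt ft ε) {t : ℕ} (ht : t < T) (q : P)
    {B : Set (X → ℝ)} (hB : MeasurableSet B) {s : Set (Past P X t)} (hs : MeasurableSet s) :
    μ (pastBefore pstar f pt ft ε t ⁻¹' s ∩ {ω | pt t ω = q ∧ ft t ω ∈ B})
      = ∫⁻ ω in pastBefore pstar f pt ft ε t ⁻¹' s,
          ENNReal.ofReal (hyperPost P₁ m k σ t (runHist am f ft ε t ω).1
            (runHist am f ft ε t ω).2 q)
          * gpPostKernel (m q) (k q) σ t (runHist am f ft ε t ω) B ∂μ := by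
  have hpast := hrun.measurable_pastBefore ht.le
  set E := {ω | pt t ω = q ∧ ft t ω ∈ B} with hE
  set A := pastBefore pstar f pt ft ε t ⁻¹' s with hA
  have hEm : MeasurableSet E :=
    (hrun.measurable_pt t ht (measurableSet_singleton q)).inter (hrun.measurable_ft t ht hB)
  have hAm : MeasurableSet A := hpast hs
  have hle := hpast.comap_le
  have hlaw := hrun.law_sample t ht q B hB
  have h1 : Integrable (E.indicator (fun _ => (1 : ℝ))) μ :=
    (integrable_const 1).indicator hEm
  have h2 := setIntegral_condExp hle h1 (s := A) ⟨s, hs, rfl⟩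
  rw [setIntegral_congr_ae hAm (hlaw.mono fun ω h _ => h), setIntegral_indicator hEm] at h2
  simp only [setIntegral_const, smul_eq_mul, mul_one] at h2
  have h3 := congrArg ENNReal.ofReal h2
  rw [ofReal_measureReal, ofReal_integral_eq_lintegral_ofReal
    (integrable_condExp.congr hlaw).restrict] at h3
  · rw [← h3]
    refine lintegral_congr fun ω => ?_
    rw [ENNReal.ofReal_mul (hyperPost_nonneg P₁ m k σ t (_, _) q), ofReal_measureReal]
    rfl
  · exact Filter.Eventually.of_forall fun ω =>
      mul_nonneg (hyperPost_nonneg P₁ m k σ t (_, _) q) measureReal_nonneg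

/-- Given the past, the sampled prior and function follow the hyperposterior. -/
lemma IsRun.map_sample [IsProbabilityMeasure μ] (hk : ∀ p, (Matrix.of (k p)).PosSemidef)
    (hσ : 0 < σ) (hrun : IsRun P₁ m k σ am T μ pstar f pt ft ε) (ham : Measurable am) {t : ℕ}
    (ht : t < T) :
    μ.map (fun ω => (pastBefore pstar f pt ft ε t ω, (pt t ω, ft t ω)))
      = (μ.map (pastBefore pstar f pt ft ε t)) ⊗ₘ
        ((hyperKernel P₁ m k σ t).comap (histOf am t) (measurable_histOf ham t)) := by
  have := isMarkovKernel_hyperKernel P₁ m hk hσ t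
  have hpast := hrun.measurable_pastBefore ht.le
  have hpt := hrun.measurable_pt t ht
  have hft := hrun.measurable_ft t ht
  have := Measure.isProbabilityMeasure_map (μ := μ)
    (f := fun ω => (pastBefore pstar f pt ft ε t ω, (pt t ω, ft t ω))) (by fun_prop)
  refine Measure.ext_prod fun {s B} hs hB => ?_
  rw [Measure.map_apply (by fun_prop) (hs.prod hB), Measure.compProd_apply_prod hs hB,
    setLIntegral_map hs (Kernel.measurable_coe _ hB) hpast]
  have hBq : ∀ q : P, MeasurableSet (Prod.mk q ⁻¹' B) := fun q => measurable_prodMk_left hB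
  have hset : (fun ω => (pastBefore pstar f pt ft ε t ω, (pt t ω, ft t ω))) ⁻¹' (s ×ˢ B)
      = ⋃ q, (pastBefore pstar f pt ft ε t ⁻¹' s
        ∩ {ω | pt t ω = q ∧ ft t ω ∈ Prod.mk q ⁻¹' B}) := by
    ext ω
    simp
  rw [hset, measure_iUnion, tsum_fintype]
  · simp only [hrun.measure_sample ht _ (hBq _) hs]
    have h := hrun.measurable_runHist ham ht.le
    have hm : ∀ q, Measurable fun ω => ENNReal.ofReal (hyperPost P₁ m k σ t
        (runHist am f ft ε t ω).1 (runHist am f ft ε t ω).2 q)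
          * gpPostKernel (m q) (k q) σ t (runHist am f ft ε t ω) (Prod.mk q ⁻¹' B) := by
      intro q
      have h1 := ((measurable_hyperPost P₁ m k σ t q).comp h).ennreal_ofReal
      have h2 := (Kernel.measurable_coe (gpPostKernel (m q) (k q) σ t) (hBq q)).comp h
      exact h1.mul h2
    rw [← lintegral_finsetSum _ fun q _ => hm q]
    · refine lintegral_congr fun ω => ?_
      rw [Kernel.comap_apply, hyperKernel_apply]
      simp only [Measure.finsetSum_apply, Measure.smul_apply, smul_eq_mul,
        Measure.map_apply measurable_prodMk_left hB]
      rfl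
  · intro q q' hqq
    refine Set.disjoint_left.2 fun ω h h' => hqq ?_
    exact h.2.1.symm.trans h'.2.1
  · intro q
    exact (hpast hs).inter ((hpt (measurableSet_singleton q)).inter (hft (hBq q)))

/-- The integrand may involve the whole past, including the truth, but the kernel sees only the
history. This is the source of the conditional independence of truth and sample. -/
lemma IsRun.lintegral_sample [IsProbabilityMeasure μ] (hk : ∀ p, (Matrix.of (k p)).PosSemidef)
    (hσ : 0 < σ) (hrun : IsRun P₁ m k σ am T μ pstar f pt ft ε) (ham : Measurable am) {t : ℕ}
    (ht : t < T) {F : Past P X t × (P × (X → ℝ)) → ℝ≥0∞} (hF : Measurable F) :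
    ∫⁻ ω, F (pastBefore pstar f pt ft ε t ω, (pt t ω, ft t ω)) ∂μ
      = ∫⁻ ω, ∫⁻ z, F (pastBefore pstar f pt ft ε t ω, z)
          ∂(hyperKernel P₁ m k σ t (runHist am f ft ε t ω)) ∂μ := by
  have := isMarkovKernel_hyperKernel P₁ m hk hσ t
  have hpast := hrun.measurable_pastBefore ht.le
  have hpt := hrun.measurable_pt t ht
  have hft := hrun.measurable_ft t ht
  rw [← lintegral_map (f := F) hF (g := fun ω => (pastBefore pstar f pt ft ε t ω, (pt t ω, ft t ω)))
    (by fun_prop), hrun.map_sample hk hσ ham ht, Measure.lintegral_compProd hF, lintegral_map _ hpast]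
  · rfl
  · exact Measurable.lintegral_kernel_prod_right' hF

omit [MeasurableSpace X] [MeasurableSingletonClass X] [MeasurableSingletonClass P] in
lemma IsRun.lintegral_noise [IsProbabilityMeasure μ]
    (hrun : IsRun P₁ m k σ am T μ pstar f pt ft ε) {t : ℕ}
    (ht : t < T) {F : (Past P X t × (P × (X → ℝ))) × ℝ → ℝ≥0∞} (hF : Measurable F) :
    ∫⁻ ω, F ((pastBefore pstar f pt ft ε t ω, (pt t ω, ft t ω)), ε t ω) ∂μ
      = ∫⁻ ω, ∫⁻ e, F ((pastBefore pstar f pt ft ε t ω, (pt t ω, ft t ω)), e)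
          ∂(gaussianReal 0 (σ ^ 2)) ∂μ := by
  have hpast := hrun.measurable_pastBefore ht.le
  have hpt := hrun.measurable_pt t ht
  have hft := hrun.measurable_ft t ht
  have hε := hrun.measurable_noise t ht
  have hw : Measurable fun ω => (pastBefore pstar f pt ft ε t ω, (pt t ω, ft t ω)) := by fun_prop
  have h := (hrun.indep_noise t ht).symm.map_prod_eq_prod_map_map hw.aemeasurable hε.aemeasurable
  rw [← lintegral_map (f := F) hF (g := fun ω =>
    ((pastBefore pstar f pt ft ε t ω, (pt t ω, ft t ω)), ε t ω)) (hw.prodMk hε), h,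
    (hrun.law_noise t ht).map_eq, lintegral_prod _ hF.aemeasurable, lintegral_map _ hw]
  exact hF.lintegral_prod_right'

omit [MeasurableSpace X] [MeasurableSingletonClass X] in
/-- The joint law of the true prior and the reward function. -/
lemma IsRun.lintegral_prior [IsProbabilityMeasure μ]
    (hrun : IsRun P₁ m k σ am T μ pstar f pt ft ε) {F : P × (X → ℝ) → ℝ≥0∞} (hF : Measurable F) :
    ∫⁻ ω, F (pstar ω, f ω) ∂μ = ∑ p, P₁ p * ∫⁻ g, F (p, g) ∂(gpLaw (m p) (k p)) := by
  have hp := hrun.measurable_pstar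
  have hf := hrun.measurable_f
  have h : μ.map (fun ω => (pstar ω, f ω))
      = ∑ p, P₁ p • (gpLaw (m p) (k p)).map (Prod.mk p) := by
    ext B hB
    rw [Measure.map_apply (hp.prodMk hf) hB]
    have hset : (fun ω => (pstar ω, f ω)) ⁻¹' B
        = ⋃ q, {ω | pstar ω = q ∧ f ω ∈ Prod.mk q ⁻¹' B} := by
      ext ω
      simp
    rw [hset, measure_iUnion, tsum_fintype]
    · simp only [hrun.law_prior _ _ (measurable_prodMk_left hB), Measure.finsetSum_apply,
        Measure.map_apply measurable_prodMk_left hB, Measure.smul_apply, smul_eq_mul]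
    · intro q q' hqq
      refine Set.disjoint_left.2 fun ω h h' => hqq ?_
      exact h.1.symm.trans h'.1
    · intro q
      exact (hp (measurableSet_singleton q)).inter (hf (measurable_prodMk_left hB))
  rw [← lintegral_map (f := F) hF (hp.prodMk hf), h, lintegral_finsetSum_measure]
  refine Finset.sum_congr rfl fun p _ => ?_
  rw [lintegral_smul_measure, lintegral_map hF measurable_prodMk_left, smul_eq_mul]

omit [DecidableEq X] [Fintype P] [MeasurableSingletonClass P] in
lemma measurable_snoc_noise (ham : Measurable am) {t : ℕ}
    {F : Hist X (t + 1) × (P × (X → ℝ)) → ℝ≥0∞} (hF : Measurable F) :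
    Measurable fun w : (Hist X t × (P × (X → ℝ))) × (P × (X → ℝ)) =>
      ∫⁻ e, F (w.1.1.snoc (am w.2.2) (w.1.2.2 (am w.2.2) + e), w.1.2)
        ∂(gaussianReal 0 (σ ^ 2)) := by
  have ha : Measurable fun w : ((Hist X t × (P × (X → ℝ))) × (P × (X → ℝ))) × ℝ => am w.1.2.2 :=
    ham.comp (by fun_prop)
  have he : Measurable fun w : ((Hist X t × (P × (X → ℝ))) × (P × (X → ℝ))) × ℝ =>
      w.1.1.2.2 (am w.1.2.2) :=
    measurable_eval_uncurry.comp (f := fun w : ((Hist X t × (P × (X → ℝ))) × (P × (X → ℝ))) × ℝ =>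
      (w.1.1.2.2, am w.1.2.2)) (Measurable.prodMk (by fun_prop) ha)
  exact Measurable.lintegral_prod_right'
    (f := fun w : ((Hist X t × (P × (X → ℝ))) × (P × (X → ℝ))) × ℝ =>
      F (w.1.1.1.snoc (am w.1.2.2) (w.1.1.2.2 (am w.1.2.2) + w.2), w.1.1.2))
    (hF.comp ((Hist.measurable_snoc (by fun_prop) ha (he.add measurable_snd)).prodMk
      (by fun_prop)))

/-- One round of a run, once the posterior is known before that round. -/
lemma IsRun.lintegral_round [IsProbabilityMeasure μ] (hk : ∀ p, (Matrix.of (k p)).PosSemidef)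
    (hσ : 0 < σ) (hrun : IsRun P₁ m k σ am T μ pstar f pt ft ε) (ham : Measurable am) {t : ℕ}
    (ht : t < T)
    (hpost : ∀ F : Hist X t × (P × (X → ℝ)) → ℝ≥0∞, Measurable F →
      ∫⁻ ω, F (runHist am f ft ε t ω, (pstar ω, f ω)) ∂μ
        = ∫⁻ ω, ∫⁻ z, F (runHist am f ft ε t ω, z)
          ∂(hyperKernel P₁ m k σ t (runHist am f ft ε t ω)) ∂μ)
    {F : Hist X (t + 1) × (P × (X → ℝ)) → ℝ≥0∞} (hF : Measurable F) :
    ∫⁻ ω, F (runHist am f ft ε (t + 1) ω, (pstar ω, f ω)) ∂μ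
      = ∫⁻ ω, ∫⁻ w, ∫⁻ z, ∫⁻ e,
          F ((runHist am f ft ε t ω).snoc (am w.2) (z.2 (am w.2) + e), z)
          ∂(gaussianReal 0 (σ ^ 2)) ∂(hyperKernel P₁ m k σ t (runHist am f ft ε t ω))
          ∂(hyperKernel P₁ m k σ t (runHist am f ft ε t ω)) ∂μ := by
  have := isMarkovKernel_hyperKernel P₁ m hk hσ t
  have hS := measurable_snoc_noise (σ := σ) ham hF
  have hH := measurable_histOf (P := P) ham t
  have ha : Measurable fun w : (Past P X t × (P × (X → ℝ))) × ℝ => am w.1.2.2 :=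
    ham.comp (by fun_prop)
  have he : Measurable fun w : (Past P X t × (P × (X → ℝ))) × ℝ => w.1.1.1.2 (am w.1.2.2) :=
    measurable_eval_uncurry.comp (f := fun w : (Past P X t × (P × (X → ℝ))) × ℝ =>
      (w.1.1.1.2, am w.1.2.2)) (Measurable.prodMk (by fun_prop) ha)
  calc ∫⁻ ω, F (runHist am f ft ε (t + 1) ω, (pstar ω, f ω)) ∂μ
      = ∫⁻ ω, ∫⁻ e, F ((runHist am f ft ε t ω).snoc (am (ft t ω)) (f ω (am (ft t ω)) + e),
          (pstar ω, f ω)) ∂(gaussianReal 0 (σ ^ 2)) ∂μ := by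
        simp only [runHist_succ]
        exact hrun.lintegral_noise ht
          (F := fun w => F ((histOf am t w.1.1).snoc (am w.1.2.2) (w.1.1.1.2 (am w.1.2.2) + w.2),
            w.1.1.1))
          (hF.comp ((Hist.measurable_snoc (hH.comp (by fun_prop)) ha
            (he.add measurable_snd)).prodMk (by fun_prop)))
    _ = ∫⁻ ω, ∫⁻ w, ∫⁻ e, F ((runHist am f ft ε t ω).snoc (am w.2) (f ω (am w.2) + e),
          (pstar ω, f ω)) ∂(gaussianReal 0 (σ ^ 2))
          ∂(hyperKernel P₁ m k σ t (runHist am f ft ε t ω)) ∂μ := by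
        exact hrun.lintegral_sample hk hσ ham ht
          (F := fun w => ∫⁻ e, F ((histOf am t w.1).snoc (am w.2.2) (w.1.1.2 (am w.2.2) + e),
            w.1.1) ∂(gaussianReal 0 (σ ^ 2)))
          (hS.comp (f := fun w : Past P X t × (P × (X → ℝ)) => ((histOf am t w.1, w.1.1), w.2))
            (by fun_prop))
    -- With noise and sample integrated out, the integrand depends only on the history and the
    -- truth, so the known posterior before the round, `hpost`, applies.
    _ = ∫⁻ ω, ∫⁻ z, ∫⁻ w, ∫⁻ e,
          F ((runHist am f ft ε t ω).snoc (am w.2) (z.2 (am w.2) + e), z)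
          ∂(gaussianReal 0 (σ ^ 2)) ∂(hyperKernel P₁ m k σ t (runHist am f ft ε t ω))
          ∂(hyperKernel P₁ m k σ t (runHist am f ft ε t ω)) ∂μ := by
        exact hpost (fun y => ∫⁻ w, ∫⁻ e,
          F (y.1.snoc (am w.2) (y.2.2 (am w.2) + e), y.2)
          ∂(gaussianReal 0 (σ ^ 2)) ∂(hyperKernel P₁ m k σ t y.1))
          (Measurable.lintegral_kernel_prod_right'
            (κ := (hyperKernel P₁ m k σ t).comap Prod.fst measurable_fst) hS)
    -- The order is swapped so that the arm `am w.2` is fixed before the truth is integrated, which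
    -- is the setting of Bayes' rule.
    _ = _ := by
        refine lintegral_congr fun ω => ?_
        exact lintegral_lintegral_swap (f := fun (z w : P × (X → ℝ)) => ∫⁻ e,
          F ((runHist am f ft ε t ω).snoc (am w.2) (z.2 (am w.2) + e), z)
          ∂(gaussianReal 0 (σ ^ 2))) (hS.comp
          (f := fun y : (P × (X → ℝ)) × (P × (X → ℝ)) => ((runHist am f ft ε t ω, y.1), y.2))
          (by fun_prop)).aemeasurable

/-- Given the history, the true prior and the reward function follow the hyperposterior. -/
theorem IsRun.lintegral_posterior [IsProbabilityMeasure μ]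
    (hk : ∀ p, (Matrix.of (k p)).PosSemidef)
    (hσ : 0 < σ) (hrun : IsRun P₁ m k σ am T μ pstar f pt ft ε) (ham : Measurable am) {t : ℕ}
    (ht : t ≤ T) {F : Hist X t × (P × (X → ℝ)) → ℝ≥0∞} (hF : Measurable F) :
    ∫⁻ ω, F (runHist am f ft ε t ω, (pstar ω, f ω)) ∂μ
      = ∫⁻ ω, ∫⁻ z, F (runHist am f ft ε t ω, z)
          ∂(hyperKernel P₁ m k σ t (runHist am f ft ε t ω)) ∂μ := by
  induction t with
  | zero =>
    have h0 : ∀ ω, runHist am f ft ε 0 ω = (Fin.elim0, Fin.elim0) := fun ω =>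
      Subsingleton.elim _ _
    simp only [h0]
    rw [hrun.lintegral_prior (F := fun z => F ((Fin.elim0, Fin.elim0), z))
      (hF.comp measurable_prodMk_left), lintegral_const, measure_univ, mul_one,
      lintegral_hyperKernel P₁ m k σ 0 _ (F := fun z => F ((Fin.elim0, Fin.elim0), z))
        (hF.comp measurable_prodMk_left)]
    refine Finset.sum_congr rfl fun p _ => ?_
    rw [postMean_zero, postKer_zero]
    simp [hyperPost, ENNReal.ofReal_toReal (P₁.apply_ne_top p)]
  | succ t ih =>
    have ht' : t < T := ht
    have := isMarkovKernel_hyperKernel P₁ m hk hσ (t + 1)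
    have hR := fun {F : Hist X (t + 1) × (P × (X → ℝ)) → ℝ≥0∞} (hF : Measurable F) =>
      hrun.lintegral_round hk hσ ham ht' (fun F hF => ih ht'.le hF) hF
    have hF' : Measurable fun y : Hist X (t + 1) × (P × (X → ℝ)) =>
        ∫⁻ z, F (y.1, z) ∂(hyperKernel P₁ m k σ (t + 1) y.1) :=
      (Measurable.lintegral_kernel_prod_right' (κ := hyperKernel P₁ m k σ (t + 1)) hF).comp
        measurable_fst
    -- Both sides are expanded through the same round; for a fixed history and arm the claim is the
    -- tower property.
    rw [hR hF]
    refine Eq.trans ?_ (hR hF').symm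
    refine lintegral_congr fun ω => lintegral_congr fun w => ?_
    exact lintegral_hyperKernel_tower P₁ m hk hσ t (runHist am f ft ε t ω) (am w.2)
      (F := fun y z => F ((runHist am f ft ε t ω).snoc (am w.2) y, z))
      (hF.comp ((Hist.measurable_snoc measurable_const measurable_const measurable_fst).prodMk
        measurable_snd))

end RunLaws

/-! ### Expected excess of a Gaussian over a threshold, and reflection symmetry. -/

section GaussianTail

lemma gaussianPDFReal_zero_one (z : ℝ) :
    gaussianPDFReal 0 1 z = (√(2 * Real.pi))⁻¹ * Real.exp (-z ^ 2 / 2) := by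
  simp [gaussianPDFReal]

/-- Since b ≥ 0, the excess z - b is at most z on z > b, and z φ(z) has antiderivative -φ(z), so the
bound is the density φ(b). -/
lemma lintegral_excess_gaussianReal_zero_one {b : ℝ} (hb : 0 ≤ b) :
    ∫⁻ z, ENNReal.ofReal (z - b) ∂(gaussianReal 0 1)
      ≤ ENNReal.ofReal (Real.exp (-b ^ 2 / 2) / √(2 * Real.pi)) := by
  have hderiv : ∀ z : ℝ, HasDerivAt (fun z => -gaussianPDFReal 0 1 z)
      (z * gaussianPDFReal 0 1 z) z := by
    intro z
    have h1 : HasDerivAt (fun z : ℝ => -z ^ 2 / 2) (-z) z := by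
      have := ((hasDerivAt_pow 2 z).neg).div_const 2
      refine this.congr_deriv ?_
      simp
      ring
    have h2 := (h1.exp.const_mul (√(2 * Real.pi))⁻¹).neg
    simp only [gaussianPDFReal_zero_one]
    refine h2.congr_deriv ?_
    ring
  have hpos : ∀ z ∈ Set.Ioi b, 0 ≤ z * gaussianPDFReal 0 1 z := fun z hz =>
    mul_nonneg (hb.trans (le_of_lt hz)) (gaussianPDFReal_nonneg _ _ _)
  have hlim : Filter.Tendsto (fun z => -gaussianPDFReal 0 1 z) Filter.atTop (nhds 0) := by
    simp only [gaussianPDFReal_zero_one]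
    have h1 : Filter.Tendsto (fun z : ℝ => -z ^ 2 / 2) Filter.atTop Filter.atBot := by
      have := (Filter.tendsto_pow_atTop (α := ℝ) two_ne_zero).atTop_div_const (zero_lt_two (α := ℝ))
      refine (Filter.tendsto_neg_atTop_atBot.comp this).congr fun z => ?_
      simp only [Function.comp]
      ring
    have h2 := ((Real.tendsto_exp_atBot.comp h1).const_mul (√(2 * Real.pi))⁻¹).neg
    simpa using h2
  have hint := integrableOn_Ioi_deriv_of_nonneg' (fun z _ => hderiv z) hpos hlim
  have hval := integral_Ioi_of_hasDerivAt_of_tendsto' (fun z _ => hderiv z) hint hlim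
  rw [gaussianReal_of_var_ne_zero _ one_ne_zero,
    lintegral_withDensity_eq_lintegral_mul _ (measurable_gaussianPDF _ _) (by fun_prop)]
  have h3 : Real.exp (-b ^ 2 / 2) / √(2 * Real.pi)
      = ∫ z in Set.Ioi b, z * gaussianPDFReal 0 1 z := by
    rw [hval, gaussianPDFReal_zero_one]
    ring
  rw [h3, ofReal_integral_eq_lintegral_ofReal hint
    ((ae_restrict_iff' measurableSet_Ioi).2 (Filter.Eventually.of_forall hpos)),
    ← lintegral_indicator measurableSet_Ioi]
  refine lintegral_mono fun z => ?_
  simp only [Pi.mul_apply, gaussianPDF]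
  by_cases hz : z ∈ Set.Ioi b
  · rw [Set.indicator_of_mem hz, ← ENNReal.ofReal_mul (gaussianPDFReal_nonneg _ _ _)]
    refine ENNReal.ofReal_le_ofReal ?_
    nlinarith [gaussianPDFReal_nonneg 0 1 z]
  · rw [Set.indicator_of_notMem hz, ENNReal.ofReal_of_nonpos (p := z - b), mul_zero]
    simpa using hz

/-- The expected excess of a Gaussian variable of variance at most `1` over its upper confidence
bound. -/
lemma lintegral_excess_gaussianReal (M β : ℝ) {v : ℝ} (hv0 : 0 ≤ v) (hv1 : v ≤ 1) :
    ∫⁻ y, ENNReal.ofReal (y - (M + √β * √v)) ∂(gaussianReal M v.toNNReal)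
      ≤ ENNReal.ofReal (Real.exp (-β / 2) / √(2 * Real.pi)) := by
  have h1 : gaussianReal M v.toNNReal = (gaussianReal 0 1).map (fun z => √v * z + M) := by
    have h2 := gaussianReal_map_const_mul (μ := 0) (v := 1) (√v)
    have h3 := gaussianReal_map_add_const (μ := √v * 0) (v := v.toNNReal) M
    have h4 : NNReal.mk (√v ^ 2) (sq_nonneg _) * 1 = v.toNNReal := by
      ext
      simp [Real.sq_sqrt hv0, hv0]
    rw [h4] at h2
    rw [← h2, Measure.map_map (by fun_prop) (by fun_prop)] at h3
    rw [mul_zero, zero_add] at h3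
    exact h3.symm
  rw [h1, lintegral_map (by fun_prop) (by fun_prop)]
  calc ∫⁻ z, ENNReal.ofReal (√v * z + M - (M + √β * √v)) ∂(gaussianReal 0 1)
      ≤ ∫⁻ z, ENNReal.ofReal (z - √β) ∂(gaussianReal 0 1) := by
        refine lintegral_mono fun z => ?_
        -- After standardising, the excess is √v times that of a standard normal over √β, and the
        -- factor is at most 1.
        have hs1 : √v ≤ 1 := by simpa using Real.sqrt_le_sqrt hv1
        have e : √v * z + M - (M + √β * √v) = √v * (z - √β) := by ring
        rw [e, ENNReal.ofReal_mul (Real.sqrt_nonneg v)]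
        calc _ ≤ 1 * ENNReal.ofReal (z - √β) := by
              gcongr
              simpa using ENNReal.ofReal_le_ofReal hs1
          _ = _ := one_mul _
    _ ≤ ENNReal.ofReal (Real.exp (-√β ^ 2 / 2) / √(2 * Real.pi)) :=
        lintegral_excess_gaussianReal_zero_one (Real.sqrt_nonneg β)
    _ ≤ _ := by
        refine ENNReal.ofReal_le_ofReal ?_
        gcongr
        -- For β ≤ 0 the threshold is 0, and the bound only weakens because exp(-β/2) ≥ 1.
        rcases le_total 0 β with h | h
        · rw [Real.sq_sqrt h]
        · rw [Real.sqrt_eq_zero_of_nonpos h]; simpa using h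

/-- The reflection y ↦ 2M - y preserves the law. This form of "the mean is M" lets
`IsRun.integral_reward` work with nonnegative integrals throughout. -/
lemma lintegral_sub_gaussianReal_symm (M : ℝ) (v : ℝ≥0) :
    ∫⁻ y, ENNReal.ofReal (y - M) ∂(gaussianReal M v)
      = ∫⁻ y, ENNReal.ofReal (M - y) ∂(gaussianReal M v) := by
  have h := gaussianReal_map_const_sub (μ := M) (v := v) (2 * M)
  have e : 2 * M - M = M := by ring
  rw [e] at h
  conv_lhs => rw [← h]
  rw [lintegral_map (by fun_prop) (by fun_prop)]
  refine lintegral_congr fun y => ?_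
  congr 1
  ring

end GaussianTail

/-! ### Exchangeability of the truth and the sample. -/

section Exchange

variable {Ω X P : Type*} [MeasurableSpace Ω] [Fintype X] [DecidableEq X] [MeasurableSpace X]
  [MeasurableSingletonClass X] [Fintype P] [MeasurableSpace P] [MeasurableSingletonClass P]
  {P₁ : PMF P} {m : P → X → ℝ} {k : P → X → X → ℝ} {σ : ℝ≥0} {am : (X → ℝ) → X} {T : ℕ}
  {μ : Measure Ω} {pstar : Ω → P} {f : Ω → X → ℝ} {pt : ℕ → Ω → P} {ft : ℕ → Ω → X → ℝ}
  {ε : ℕ → Ω → ℝ}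

/-- Given the history, the truth and the sample are independent and both follow the
hyperposterior. -/
lemma IsRun.lintegral_pair [IsProbabilityMeasure μ] (hk : ∀ p, (Matrix.of (k p)).PosSemidef)
    (hσ : 0 < σ) (hrun : IsRun P₁ m k σ am T μ pstar f pt ft ε) (ham : Measurable am) {t : ℕ}
    (ht : t < T) {F : Hist X t × ((P × (X → ℝ)) × (P × (X → ℝ))) → ℝ≥0∞} (hF : Measurable F) :
    ∫⁻ ω, F (runHist am f ft ε t ω, ((pstar ω, f ω), (pt t ω, ft t ω))) ∂μ
      = ∫⁻ ω, ∫⁻ z, ∫⁻ w, F (runHist am f ft ε t ω, (z, w))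
          ∂(hyperKernel P₁ m k σ t (runHist am f ft ε t ω))
          ∂(hyperKernel P₁ m k σ t (runHist am f ft ε t ω)) ∂μ := by
  have := isMarkovKernel_hyperKernel P₁ m hk hσ t
  have hH := measurable_histOf (P := P) ham t
  have h1 := hrun.lintegral_sample hk hσ ham ht (F := fun w => F (histOf am t w.1, (w.1.1, w.2)))
    (hF.comp (by fun_prop))
  have h2 := hrun.lintegral_posterior hk hσ ham ht.le
    (F := fun y => ∫⁻ w, F (y.1, (y.2, w)) ∂(hyperKernel P₁ m k σ t y.1))
    (Measurable.lintegral_kernel_prod_right'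
      (κ := (hyperKernel P₁ m k σ t).comap Prod.fst measurable_fst)
      (f := fun y : (Hist X t × (P × (X → ℝ))) × (P × (X → ℝ)) => F (y.1.1, (y.1.2, y.2)))
      (hF.comp (by fun_prop)))
  exact h1.trans h2

/-- Jointly with the history, the truth and the sample are exchangeable. -/
lemma IsRun.map_exchange [IsProbabilityMeasure μ] (hk : ∀ p, (Matrix.of (k p)).PosSemidef)
    (hσ : 0 < σ) (hrun : IsRun P₁ m k σ am T μ pstar f pt ft ε) (ham : Measurable am) {t : ℕ}
    (ht : t < T) :
    μ.map (fun ω => (runHist am f ft ε t ω, ((pstar ω, f ω), (pt t ω, ft t ω))))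
      = μ.map (fun ω => (runHist am f ft ε t ω, ((pt t ω, ft t ω), (pstar ω, f ω)))) := by
  have := isMarkovKernel_hyperKernel P₁ m hk hσ t
  have hH := hrun.measurable_runHist ham ht.le
  have hp := hrun.measurable_pstar
  have hf := hrun.measurable_f
  have hpt := hrun.measurable_pt t ht
  have hft := hrun.measurable_ft t ht
  refine Measure.ext_of_lintegral _ fun F hF => ?_
  rw [lintegral_map hF (by fun_prop), lintegral_map hF (by fun_prop),
    hrun.lintegral_pair hk hσ ham ht hF, hrun.lintegral_pair hk hσ ham ht
      (F := fun y => F (y.1, (y.2.2, y.2.1))) (hF.comp (by fun_prop))]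
  refine lintegral_congr fun ω => ?_
  exact lintegral_lintegral_swap (f := fun z w => F (runHist am f ft ε t ω, (z, w)))
    (hF.comp (by fun_prop)).aemeasurable

/-- Only equality of the two joint laws enters, so no integrability is needed. -/
lemma IsRun.integral_exchange [IsProbabilityMeasure μ] (hk : ∀ p, (Matrix.of (k p)).PosSemidef)
    (hσ : 0 < σ) (hrun : IsRun P₁ m k σ am T μ pstar f pt ft ε) (ham : Measurable am) {t : ℕ}
    (ht : t < T) {G : Hist X t × ((P × (X → ℝ)) × (P × (X → ℝ))) → ℝ} (hG : Measurable G) :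
    ∫ ω, G (runHist am f ft ε t ω, ((pstar ω, f ω), (pt t ω, ft t ω))) ∂μ
      = ∫ ω, G (runHist am f ft ε t ω, ((pt t ω, ft t ω), (pstar ω, f ω))) ∂μ := by
  have hH := hrun.measurable_runHist ham ht.le
  have hp := hrun.measurable_pstar
  have hf := hrun.measurable_f
  have hpt := hrun.measurable_pt t ht
  have hft := hrun.measurable_ft t ht
  rw [← integral_map (f := G)
    (φ := fun ω => (runHist am f ft ε t ω, ((pstar ω, f ω), (pt t ω, ft t ω))))
    (by fun_prop) hG.aestronglyMeasurable, hrun.map_exchange hk hσ ham ht,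
    integral_map (by fun_prop) hG.aestronglyMeasurable]

end Exchange

/-! ### Differential entropy and its chain rule. -/

section Entropy

lemma lintegral_pi_fin_succ (ν : Measure ℝ) [SigmaFinite ν] {n : ℕ}
    {F : (Fin (n + 1) → ℝ) → ℝ≥0∞} (hF : Measurable F) :
    ∫⁻ y, F y ∂(Measure.pi fun _ => ν)
      = ∫⁻ y, ∫⁻ w, F (Fin.snoc (α := fun _ => ℝ) y w) ∂ν ∂(Measure.pi fun _ : Fin n => ν) := by
  have h := (measurePreserving_piFinSuccAbove (fun _ : Fin (n + 1) => ν) (Fin.last n)).symm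
  have hs : Measurable fun z : (Fin n → ℝ) × ℝ =>
      (Fin.snoc (α := fun _ => ℝ) z.1 z.2 : Fin (n + 1) → ℝ) :=
    measurable_fin_snoc measurable_fst measurable_snd
  rw [← h.lintegral_comp hF, lintegral_prod_symm _ (by fun_prop)]
  refine lintegral_congr fun y => lintegral_congr fun w => ?_
  congr 1
  exact Fin.insertNth_last' w y

/-- `ν` has a positive Lebesgue density with integrable logarithm, and differential entropy `E`. -/
def HasEntropy {n : ℕ} (ν : Measure (Fin n → ℝ)) (E : ℝ) : Prop :=
  ∃ D : (Fin n → ℝ) → ℝ, Measurable D ∧ (∀ y, 0 < D y) ∧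
    ν = volume.withDensity (fun y => ENNReal.ofReal (D y)) ∧
    Integrable (fun y => Real.log (D y)) ν ∧ ∫ y, Real.log (D y) ∂ν = -E

/-- The Radon–Nikodym derivative is determined only up to Lebesgue-null sets, which are also null
for `ν`. -/
lemma HasEntropy.diffEntropy_eq {n : ℕ} {ν : Measure (Fin n → ℝ)} {E : ℝ} (h : HasEntropy ν E) :
    diffEntropy ν = E := by
  obtain ⟨D, hD, hpos, hν, -, hE⟩ := h
  have h1 : ν.rnDeriv volume =ᵐ[volume] fun y => ENNReal.ofReal (D y) := by
    rw [hν]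
    exact Measure.rnDeriv_withDensity _ hD.ennreal_ofReal
  have hac : ν ≪ volume := by
    rw [hν]
    exact withDensity_absolutelyContinuous _ _
  have h2 : (fun y => Real.log ((ν.rnDeriv volume y).toReal)) =ᵐ[ν] fun y => Real.log (D y) := by
    filter_upwards [hac.ae_le h1] with y hy
    rw [hy, ENNReal.toReal_ofReal (hpos y).le]
  rw [diffEntropy, integral_congr_ae h2, hE, neg_neg]

/-- On a one-point space Lebesgue measure is itself the only probability measure, so the density is
1. -/
lemma hasEntropy_zero (ν : Measure (Fin 0 → ℝ)) [IsProbabilityMeasure ν] : HasEntropy ν 0 := by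
  refine ⟨fun _ => 1, measurable_const, fun _ => one_pos, ?_, by simp, by simp⟩
  simp only [ENNReal.ofReal_one]
  have h : (fun _ : Fin 0 → ℝ => (1 : ℝ≥0∞)) = 1 := rfl
  rw [h, withDensity_one]
  have : ∀ (ν₁ ν₂ : Measure (Fin 0 → ℝ)) [IsProbabilityMeasure ν₁] [IsProbabilityMeasure ν₂],
      ν₁ = ν₂ := by
    intro ν₁ ν₂ _ _
    ext s _
    rcases Set.eq_empty_or_nonempty s with rfl | hs
    · simp
    · rw [Subsingleton.eq_univ_of_nonempty hs, measure_univ, measure_univ]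
  have hv : IsProbabilityMeasure (volume : Measure (Fin 0 → ℝ)) := by
    exact ⟨by simp [volume_pi]⟩
  exact this _ _

lemma log_gaussianPDFReal {s : ℝ≥0} (hs : s ≠ 0) (w : ℝ) :
    Real.log (gaussianPDFReal 0 s w)
      = -(1 / 2 * Real.log (2 * Real.pi * s)) - w ^ 2 / (2 * s) := by
  have hs' : (0 : ℝ) < s := by positivity
  have h : 0 < 2 * Real.pi * s := by positivity
  rw [gaussianPDFReal, Real.log_mul (by positivity) (Real.exp_pos _).ne', Real.log_exp,
    Real.log_inv, Real.log_sqrt h.le]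
  ring

lemma integrable_log_gaussianPDFReal {s : ℝ≥0} (hs : s ≠ 0) :
    Integrable (fun w => Real.log (gaussianPDFReal 0 s w)) (gaussianReal 0 s) := by
  simp only [log_gaussianPDFReal hs]
  have h2 : Integrable (fun w : ℝ => w ^ 2) (gaussianReal 0 s) :=
    (memLp_id_gaussianReal (μ := 0) (v := s) 2).integrable_sq
  exact (integrable_const _).sub (h2.div_const _)

lemma integral_log_gaussianPDFReal {s : ℝ≥0} (hs : s ≠ 0) :
    ∫ w, Real.log (gaussianPDFReal 0 s w) ∂(gaussianReal 0 s)
      = -(1 / 2 * Real.log (2 * Real.pi * s) + 1 / 2) := by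
  have h2 : Integrable (fun w : ℝ => w ^ 2) (gaussianReal 0 s) :=
    (memLp_id_gaussianReal (μ := 0) (v := s) 2).integrable_sq
  have hvar : ∫ w, w ^ 2 ∂(gaussianReal 0 s) = s := by
    have h3 := variance_fun_id_gaussianReal (μ := 0) (v := s)
    rw [variance_of_integral_eq_zero (by fun_prop) (by simp [integral_id_gaussianReal])] at h3
    exact h3
  have hs' : (s : ℝ) ≠ 0 := by exact_mod_cast hs
  simp only [log_gaussianPDFReal hs]
  rw [integral_sub (integrable_const _) (h2.div_const _), integral_div, hvar]
  simp
  field_simp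
  ring

/-- The law on `ℝⁿ⁺¹` whose first `n` coordinates have law `ν` and whose last coordinate is
Gaussian with mean `c y` and variance `s` given the first ones. -/
def gaussianStep {n : ℕ} (ν : Measure (Fin n → ℝ)) (c : (Fin n → ℝ) → ℝ) (s : ℝ≥0) :
    Measure (Fin (n + 1) → ℝ) :=
  (ν.prod (gaussianReal 0 s)).map (fun z => Fin.snoc (α := fun _ => ℝ) z.1 (c z.1 + z.2))

lemma measurable_gaussianStep_map {n : ℕ} {c : (Fin n → ℝ) → ℝ} (hc : Measurable c) :
    Measurable fun z : (Fin n → ℝ) × ℝ =>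
      (Fin.snoc (α := fun _ => ℝ) z.1 (c z.1 + z.2) : Fin (n + 1) → ℝ) :=
  measurable_fin_snoc measurable_fst (by fun_prop)

lemma lintegral_gaussianStep {n : ℕ} (ν : Measure (Fin n → ℝ)) [SFinite ν]
    {c : (Fin n → ℝ) → ℝ} (hc : Measurable c) {s : ℝ≥0} (hs : s ≠ 0)
    {F : (Fin (n + 1) → ℝ) → ℝ≥0∞} (hF : Measurable F) :
    ∫⁻ y, F y ∂(gaussianStep ν c s)
      = ∫⁻ y, ∫⁻ w, gaussianPDF (c y) s w * F (Fin.snoc (α := fun _ => ℝ) y w) ∂volume ∂ν := by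
  have hm := measurable_gaussianStep_map hc
  rw [gaussianStep, lintegral_map hF hm, lintegral_prod _ (by fun_prop)]
  refine lintegral_congr fun y => ?_
  have hsn : Measurable fun w : ℝ => F (Fin.snoc (α := fun _ => ℝ) y w) :=
    hF.comp (measurable_fin_snoc measurable_const measurable_id)
  have h := gaussianReal_map_const_add (μ := 0) (v := s) (c y)
  rw [zero_add] at h
  have h2 : ∫⁻ w, F (Fin.snoc (α := fun _ => ℝ) y w) ∂(gaussianReal (c y) s)
      = ∫⁻ w, F (Fin.snoc (α := fun _ => ℝ) y (c y + w)) ∂(gaussianReal 0 s) := by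
    rw [← h, lintegral_map hsn (by fun_prop)]
  rw [← h2, gaussianReal_of_var_ne_zero _ hs,
    lintegral_withDensity_eq_lintegral_mul _ (measurable_gaussianPDF _ _) hsn]
  rfl

/-- The chain rule for the differential entropy with a Gaussian last coordinate. -/
lemma HasEntropy.gaussianStep {n : ℕ} {ν : Measure (Fin n → ℝ)} [IsProbabilityMeasure ν] {E : ℝ}
    (h : HasEntropy ν E) {c : (Fin n → ℝ) → ℝ} (hc : Measurable c) {s : ℝ≥0} (hs : s ≠ 0) :
    HasEntropy (gaussianStep ν c s) (E + (1 / 2 * Real.log (2 * Real.pi * s) + 1 / 2)) := by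
  obtain ⟨D, hD, hpos, hν, hint, hE⟩ := h
  have hm := measurable_gaussianStep_map hc
  set D' : (Fin (n + 1) → ℝ) → ℝ := fun y => D (fun i => y (Fin.castSucc i)) *
    gaussianPDFReal (c (fun i => y (Fin.castSucc i))) s (y (Fin.last n)) with hD'
  have hD'm : Measurable D' := by
    refine (hD.comp (by fun_prop)).mul ?_
    exact measurable_uncurry_gaussianPDFReal.comp
      (f := fun y : Fin (n + 1) → ℝ => (c (fun i => y (Fin.castSucc i)), s, y (Fin.last n)))
      ((hc.comp (by fun_prop)).prodMk (measurable_const.prodMk (by fun_prop)))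
  -- In the coordinates (first observations, last residual) the law is a product and the logarithm
  -- of the density splits, so the two entropies add.
  have hlog : ∀ z : (Fin n → ℝ) × ℝ,
      Real.log (D' (Fin.snoc (α := fun _ => ℝ) z.1 (c z.1 + z.2)))
        = Real.log (D z.1) + Real.log (gaussianPDFReal 0 s z.2) := by
    intro z
    simp only [hD', Fin.snoc_castSucc, Fin.snoc_last]
    rw [Real.log_mul (hpos _).ne' (gaussianPDFReal_pos _ _ _ hs).ne']
    congr 2
    simp [gaussianPDFReal]
  have hi1 := hint.comp_fst (gaussianReal 0 s)
  have hi2 := (integrable_log_gaussianPDFReal hs).comp_snd ν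
  refine ⟨D', hD'm, fun y => mul_pos (hpos _) (gaussianPDFReal_pos _ _ _ hs), ?_, ?_, ?_⟩
  · refine Measure.ext_of_lintegral _ fun F hF => ?_
    rw [lintegral_gaussianStep ν hc hs hF,
      lintegral_withDensity_eq_lintegral_mul _ hD'm.ennreal_ofReal hF, volume_pi,
      lintegral_pi_fin_succ volume (hD'm.ennreal_ofReal.mul hF), hν,
      lintegral_withDensity_eq_lintegral_mul _ hD.ennreal_ofReal, volume_pi]
    · refine lintegral_congr fun y => ?_
      simp only [Pi.mul_apply]
      rw [← lintegral_const_mul]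
      · refine lintegral_congr fun w => ?_
        simp only [hD', Fin.snoc_castSucc, Fin.snoc_last]
        rw [ENNReal.ofReal_mul (hpos y).le, mul_assoc]
        rfl
      · exact (measurable_gaussianPDF _ _).mul
          (hF.comp (measurable_fin_snoc measurable_const measurable_id))
    · refine Measurable.lintegral_prod_right' (f := fun z : (Fin n → ℝ) × ℝ =>
        gaussianPDF (c z.1) s z.2 * F (Fin.snoc (α := fun _ => ℝ) z.1 z.2)) ?_
      refine Measurable.mul ?_ (hF.comp (measurable_fin_snoc measurable_fst measurable_snd))
      exact measurable_uncurry_gaussianPDF.comp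
        (f := fun z : (Fin n → ℝ) × ℝ => (c z.1, s, z.2)) (by fun_prop)
  · rw [HPGP.gaussianStep, integrable_map_measure hD'm.log.aestronglyMeasurable hm.aemeasurable]
    refine (hi1.add hi2).congr (Filter.Eventually.of_forall fun z => ?_)
    exact (hlog z).symm
  · rw [HPGP.gaussianStep, integral_map hm.aemeasurable hD'm.log.aestronglyMeasurable]
    simp only [hlog]
    rw [integral_add hi1 hi2, integral_fun_fst (f := fun y => Real.log (D y)),
      integral_fun_snd (f := fun w => Real.log (gaussianPDFReal 0 s w)), hE,
      integral_log_gaussianPDFReal hs]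
    simp
    ring

end Entropy

/-! ### Information gain of one further observation. -/

section InformationGain

instance (σ : ℝ≥0) (n : ℕ) : IsProbabilityMeasure (noiseLaw σ n) := by
  unfold noiseLaw
  infer_instance

lemma lintegral_noiseLaw_succ (σ : ℝ≥0) {n : ℕ} {F : (Fin (n + 1) → ℝ) → ℝ≥0∞}
    (hF : Measurable F) :
    ∫⁻ e, F e ∂(noiseLaw σ (n + 1))
      = ∫⁻ e, ∫⁻ w, F (Fin.snoc (α := fun _ => ℝ) e w) ∂(gaussianReal 0 (σ ^ 2))
          ∂(noiseLaw σ n) :=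
  lintegral_pi_fin_succ (gaussianReal 0 (σ ^ 2)) hF

lemma add_snoc {n : ℕ} (a : Fin (n + 1) → ℝ) (e : Fin n → ℝ) (w : ℝ) :
    (fun i => a i + (Fin.snoc (α := fun _ => ℝ) e w : Fin (n + 1) → ℝ) i)
      = Fin.snoc (α := fun _ => ℝ) (fun i => a (Fin.castSucc i) + e i) (a (Fin.last n) + w) := by
  ext i
  refine Fin.lastCases ?_ (fun i => ?_) i <;> simp

lemma map_add_noiseLaw_succ (σ : ℝ≥0) {n : ℕ} (a : Fin (n + 1) → ℝ) :
    (noiseLaw σ (n + 1)).map (fun e i => a i + e i)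
      = gaussianStep ((noiseLaw σ n).map (fun e i => a (Fin.castSucc i) + e i))
          (fun _ => a (Fin.last n)) (σ ^ 2) := by
  have hm : Measurable fun (e : Fin n → ℝ) (i : Fin n) => a (Fin.castSucc i) + e i := by fun_prop
  have := Measure.isProbabilityMeasure_map (μ := noiseLaw σ n) hm.aemeasurable
  have hs := measurable_gaussianStep_map (n := n) (c := fun _ => a (Fin.last n)) measurable_const
  refine Measure.ext_of_lintegral _ fun F hF => ?_
  rw [lintegral_map hF (by fun_prop), lintegral_noiseLaw_succ σ (by fun_prop), gaussianStep,
    lintegral_map hF hs, lintegral_prod _ (by fun_prop), lintegral_map _ hm]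
  · simp only [add_snoc]
  · exact Measurable.lintegral_prod_right' (f := fun z : (Fin n → ℝ) × ℝ =>
      F (Fin.snoc (α := fun _ => ℝ) z.1 (a (Fin.last n) + z.2))) (hF.comp hs)

/-- The chain rule with constant conditional mean. The value is independent of the shift `a`, so
averaging the conditional entropy over the process changes nothing. -/
lemma hasEntropy_map_add_noiseLaw {σ : ℝ≥0} (hσ : 0 < σ) {n : ℕ} (a : Fin n → ℝ) :
    HasEntropy ((noiseLaw σ n).map (fun e i => a i + e i))
      (n * (1 / 2 * Real.log (2 * Real.pi * (σ : ℝ) ^ 2) + 1 / 2)) := by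
  have hp : ∀ {n : ℕ} (a : Fin n → ℝ),
      IsProbabilityMeasure ((noiseLaw σ n).map (fun e i => a i + e i)) := by
    intro n a
    exact Measure.isProbabilityMeasure_map (Measurable.aemeasurable (by fun_prop))
  induction n with
  | zero =>
    have := hp a
    simpa using hasEntropy_zero ((noiseLaw σ 0).map (fun e i => a i + e i))
  | succ n ih =>
    rw [map_add_noiseLaw_succ]
    have := hp fun i => a (Fin.castSucc i)
    have h := (ih fun i => a (Fin.castSucc i)).gaussianStep
      (c := fun _ => a (Fin.last n)) measurable_const (s := σ ^ 2) (by positivity)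
    convert h using 1
    push_cast
    ring

variable {X : Type*} [Fintype X] [DecidableEq X]

/-- The law of the noisy observations of a Gaussian process at the arms `A`. -/
def obsLaw (m : X → ℝ) (k : X → X → ℝ) (σ : ℝ≥0) {n : ℕ} (A : Fin n → X) :
    Measure (Fin n → ℝ) :=
  ((gpLaw m k).prod (noiseLaw σ n)).map (fun z i => z.1 (A i) + z.2 i)

instance (m : X → ℝ) (k : X → X → ℝ) (σ : ℝ≥0) {n : ℕ} (A : Fin n → X) :
    IsProbabilityMeasure (obsLaw m k σ A) :=
  Measure.isProbabilityMeasure_map (by fun_prop)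

lemma lintegral_obsLaw (m : X → ℝ) (k : X → X → ℝ) (σ : ℝ≥0) {n : ℕ} (A : Fin n → X)
    {F : (Fin n → ℝ) → ℝ≥0∞} (hF : Measurable F) :
    ∫⁻ y, F y ∂(obsLaw m k σ A)
      = ∫⁻ g, ∫⁻ e, F (fun i => g (A i) + e i) ∂(noiseLaw σ n) ∂(gpLaw m k) := by
  rw [obsLaw, lintegral_map hF (by fun_prop), lintegral_prod _ (by fun_prop)]

variable [MeasurableSpace X] [MeasurableSingletonClass X]

/-- The disintegration of the process and its observations at `A`: the observations have law
`obsLaw` and, given them, the process follows the posterior. -/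
def ObsDisintegration (m : X → ℝ) (k : X → X → ℝ) (σ : ℝ≥0) {n : ℕ} (A : Fin n → X) : Prop :=
  ∀ F : (Fin n → ℝ) × (X → ℝ) → ℝ≥0∞, Measurable F →
    ∫⁻ g, ∫⁻ e, F (fun i => g (A i) + e i, g) ∂(noiseLaw σ n) ∂(gpLaw m k)
      = ∫⁻ y, ∫⁻ g, F (y, g) ∂(gpPostKernel m k σ n (A, y)) ∂(obsLaw m k σ A)

/-- The variance of the prediction of the last arm of `A` from the others, with noise. -/
def predVar (k : X → X → ℝ) (σ : ℝ≥0) {n : ℕ} (A : Fin (n + 1) → X) : ℝ≥0 :=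
  Real.toNNReal (postKer k σ (fun i => A (Fin.castSucc i)) (A (Fin.last n)) (A (Fin.last n))
    + (σ : ℝ) ^ 2)

variable (m : X → ℝ) {k : X → X → ℝ} {σ : ℝ≥0}

omit [DecidableEq X] [MeasurableSpace X] [MeasurableSingletonClass X] in
lemma predVar_ne_zero (hk : (Matrix.of k).PosSemidef) (hσ : 0 < σ) {n : ℕ}
    (A : Fin (n + 1) → X) : predVar k σ A ≠ 0 := by
  simpa [predVar] using postKer_diag_add_pos hk hσ (fun i => A (Fin.castSucc i)) (A (Fin.last n))

/-- The first `n` observations are disintegrated by hypothesis, and the last is handled by the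
one-step Bayes rule under the resulting posterior. Keeping the process as an argument of `F` gives
both the law of the observations and the next disintegration. -/
lemma lintegral_obs_succ (hk : (Matrix.of k).PosSemidef) (hσ : 0 < σ) {n : ℕ}
    (A : Fin (n + 1) → X) (hA : ObsDisintegration m k σ fun i => A (Fin.castSucc i))
    {F : (Fin (n + 1) → ℝ) × (X → ℝ) → ℝ≥0∞} (hF : Measurable F) :
    ∫⁻ g, ∫⁻ e, F (fun i => g (A i) + e i, g) ∂(noiseLaw σ (n + 1)) ∂(gpLaw m k)
      = ∫⁻ y, ∫⁻ w, gaussianPDF (postMean m k σ (fun i => A (Fin.castSucc i)) y (A (Fin.last n)))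
          (predVar k σ A) w
          * ∫⁻ g, F (Fin.snoc (α := fun _ => ℝ) y w, g)
              ∂(gpPostKernel m k σ (n + 1) (A, Fin.snoc (α := fun _ => ℝ) y w)) ∂volume
          ∂(obsLaw m k σ fun i => A (Fin.castSucc i)) := by
  have hm : Measurable fun z : ((Fin n → ℝ) × (X → ℝ)) × ℝ =>
      F (Fin.snoc (α := fun _ => ℝ) z.1.1 (z.1.2 (A (Fin.last n)) + z.2), z.1.2) :=
    hF.comp ((measurable_fin_snoc (by fun_prop) (by fun_prop)).prodMk (by fun_prop))
  have h1 : ∀ g : X → ℝ, ∫⁻ e, F (fun i => g (A i) + e i, g) ∂(noiseLaw σ (n + 1))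
      = ∫⁻ e, ∫⁻ w, F (Fin.snoc (α := fun _ => ℝ) (fun i => g (A (Fin.castSucc i)) + e i)
          (g (A (Fin.last n)) + w), g) ∂(gaussianReal 0 (σ ^ 2)) ∂(noiseLaw σ n) := by
    intro g
    rw [lintegral_noiseLaw_succ σ (F := fun e => F (fun i => g (A i) + e i, g))
      (hF.comp (by fun_prop))]
    refine lintegral_congr fun e => lintegral_congr fun w => ?_
    rw [add_snoc (fun i => g (A i))]
  simp only [h1]
  rw [hA (fun z => ∫⁻ w, F (Fin.snoc (α := fun _ => ℝ) z.1 (z.2 (A (Fin.last n)) + w), z.2)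
    ∂(gaussianReal 0 (σ ^ 2))) (Measurable.lintegral_prod_right' hm)]
  refine lintegral_congr fun y => ?_
  rw [gpPostKernel_apply]
  refine (lintegral_gpLaw_bayes _ (postKer_posSemidef hk hσ _) hσ (A (Fin.last n))
    (F := fun w g => F (Fin.snoc (α := fun _ => ℝ) y w, g))
    (hF.comp ((measurable_fin_snoc measurable_const measurable_fst).prodMk
      measurable_snd))).trans ?_
  refine lintegral_congr fun w => ?_
  rw [gpPostKernel_apply, postMean_succ m hk hσ, postKer_succ hk hσ]
  simp [predVar]

/-- Test functions that ignore the process see only the predictive law of the last observation. -/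
lemma obsLaw_succ_of_disintegration (hk : (Matrix.of k).PosSemidef) (hσ : 0 < σ) {n : ℕ}
    (A : Fin (n + 1) → X) (hA : ObsDisintegration m k σ fun i => A (Fin.castSucc i)) :
    obsLaw m k σ A = gaussianStep (obsLaw m k σ fun i => A (Fin.castSucc i))
      (fun y => postMean m k σ (fun i => A (Fin.castSucc i)) y (A (Fin.last n)))
      (predVar k σ A) := by
  refine Measure.ext_of_lintegral _ fun F hF => ?_
  rw [lintegral_obsLaw m k σ A hF, lintegral_gaussianStep _
    (measurable_pi_iff.1 (measurable_postMean_right m k σ _) _) (predVar_ne_zero hk hσ A) hF,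
    lintegral_obs_succ m hk hσ A hA (F := fun z => F z.1) (hF.comp measurable_fst)]
  simp

lemma obsDisintegration (hk : (Matrix.of k).PosSemidef) (hσ : 0 < σ) {n : ℕ} (A : Fin n → X) :
    ObsDisintegration m k σ A := by
  induction n with
  | zero =>
    intro F hF
    have h0 : ∀ y : Fin 0 → ℝ, y = Fin.elim0 := fun y => Subsingleton.elim _ _
    have h1 : ∀ y : Fin 0 → ℝ, gpPostKernel m k σ 0 (A, y) = gpLaw m k := by
      intro y
      rw [gpPostKernel_apply, postMean_zero, postKer_zero]
    simp only [h1]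
    simp_rw [fun (g : X → ℝ) (e : Fin 0 → ℝ) => h0 fun i => g (A i) + e i]
    have h2 : ∀ y : Fin 0 → ℝ, ∫⁻ g, F (y, g) ∂(gpLaw m k)
        = ∫⁻ g, F (Fin.elim0, g) ∂(gpLaw m k) := fun y => by rw [h0 y]
    simp only [h2, lintegral_const, measure_univ, mul_one]
  | succ n ih =>
    intro F hF
    rw [lintegral_obs_succ m hk hσ A (ih _) hF,
      obsLaw_succ_of_disintegration m hk hσ A (ih _), lintegral_gaussianStep _
      (measurable_pi_iff.1 (measurable_postMean_right m k σ _) _) (predVar_ne_zero hk hσ A)]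
    exact Measurable.lintegral_kernel_prod_right'
      (κ := (gpPostKernel m k σ (n + 1)).comap (Prod.mk A) measurable_prodMk_left) hF

lemma obsLaw_succ (hk : (Matrix.of k).PosSemidef) (hσ : 0 < σ) {n : ℕ} (A : Fin (n + 1) → X) :
    obsLaw m k σ A = gaussianStep (obsLaw m k σ fun i => A (Fin.castSucc i))
      (fun y => postMean m k σ (fun i => A (Fin.castSucc i)) y (A (Fin.last n)))
      (predVar k σ A) :=
  obsLaw_succ_of_disintegration m hk hσ A (obsDisintegration m hk hσ _)

lemma exists_hasEntropy_obsLaw (hk : (Matrix.of k).PosSemidef) (hσ : 0 < σ) {n : ℕ}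
    (A : Fin n → X) : ∃ E, HasEntropy (obsLaw m k σ A) E := by
  induction n with
  | zero => exact ⟨0, hasEntropy_zero _⟩
  | succ n ih =>
    obtain ⟨E, hE⟩ := ih fun i => A (Fin.castSucc i)
    rw [obsLaw_succ m hk hσ]
    exact ⟨_, hE.gaussianStep (measurable_pi_iff.1 (measurable_postMean_right m k σ _) _)
      (predVar_ne_zero hk hσ A)⟩

omit [MeasurableSpace X] [MeasurableSingletonClass X] in
lemma infoGain_eq (hσ : 0 < σ) (k : X → X → ℝ) {n : ℕ} (A : Fin n → X) :
    infoGain m k σ A = diffEntropy (obsLaw m k σ A)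
      - n * (1 / 2 * Real.log (2 * Real.pi * (σ : ℝ) ^ 2) + 1 / 2) := by
  have h : ∀ g : X → ℝ, diffEntropy ((noiseLaw σ n).map (fun e i => g (A i) + e i))
      = n * (1 / 2 * Real.log (2 * Real.pi * (σ : ℝ) ^ 2) + 1 / 2) := fun g =>
    (hasEntropy_map_add_noiseLaw hσ fun i => g (A i)).diffEntropy_eq
  unfold infoGain
  simp only [h]
  simp [obsLaw]

omit [MeasurableSpace X] [MeasurableSingletonClass X] in
lemma infoGain_zero (hσ : 0 < σ) (k : X → X → ℝ) (A : Fin 0 → X) : infoGain m k σ A = 0 := by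
  rw [infoGain_eq m hσ, (hasEntropy_zero (obsLaw m k σ A)).diffEntropy_eq]
  simp

/-- One more observation increases the information gain by
`1 / 2 * log (1 + σ⁻² σ_t²(x))`. -/
lemma infoGain_succ (hk : (Matrix.of k).PosSemidef) (hσ : 0 < σ) {n : ℕ} (A : Fin (n + 1) → X) :
    infoGain m k σ A = infoGain m k σ (fun i => A (Fin.castSucc i))
      + 1 / 2 * Real.log (1 + postKer k σ (fun i => A (Fin.castSucc i)) (A (Fin.last n))
          (A (Fin.last n)) / (σ : ℝ) ^ 2) := by
  obtain ⟨E, hE⟩ := exists_hasEntropy_obsLaw m hk hσ fun i => A (Fin.castSucc i)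
  have h := hE.gaussianStep (measurable_pi_iff.1
    (measurable_postMean_right m k σ fun i => A (Fin.castSucc i)) (A (Fin.last n)))
    (predVar_ne_zero hk hσ A)
  rw [← obsLaw_succ m hk hσ] at h
  rw [infoGain_eq m hσ, infoGain_eq m hσ, h.diffEntropy_eq, hE.diffEntropy_eq]
  have hpos := postKer_diag_add_pos hk hσ (fun i => A (Fin.castSucc i)) (A (Fin.last n))
  set v := postKer k σ (fun i => A (Fin.castSucc i)) (A (Fin.last n)) (A (Fin.last n)) with hv
  have hs : (predVar k σ A : ℝ) = v + (σ : ℝ) ^ 2 := by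
    rw [predVar, Real.coe_toNNReal _ hpos.le]
  have hσ' : (0 : ℝ) < (σ : ℝ) ^ 2 := by positivity
  -- The constants of the entropy and of the noise entropy cancel, leaving half the log ratio of
  -- predictive variance to noise variance.
  have h1 : 1 + v / (σ : ℝ) ^ 2 = (v + (σ : ℝ) ^ 2) / (σ : ℝ) ^ 2 := by
    field_simp
    ring
  rw [hs, h1, Real.log_div hpos.ne' hσ'.ne', Real.log_mul (by positivity) hpos.ne',
    Real.log_mul (by positivity) hσ'.ne']
  push_cast
  ring

end InformationGain

/-! ### From information gain to summed confidence widths. -/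

section InfoBound

variable {X : Type*} [Fintype X] [DecidableEq X]

/-- The supremum runs over a finite index type, so it is genuine and not the default value. -/
lemma infoGain_le_maxInfoGain (m : X → ℝ) (k : X → X → ℝ) (σ : ℝ≥0) {n T : ℕ} (h : n ≤ T)
    (A : Fin n → X) : infoGain m k σ A ≤ maxInfoGain m k σ T :=
  le_ciSup (f := fun A : (Σ n : Fin (T + 1), (Fin n → X)) => infoGain m k σ A.2)
    (Set.finite_range _).bddAbove ⟨⟨n, Nat.lt_succ_of_le h⟩, A⟩

lemma maxInfoGain_nonneg (m : X → ℝ) (k : X → X → ℝ) {σ : ℝ≥0} (hσ : 0 < σ) (T : ℕ) :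
    0 ≤ maxInfoGain m k σ T := by
  rw [← infoGain_zero m hσ k Fin.elim0]
  exact infoGain_le_maxInfoGain m k σ T.zero_le _

/-- Bernoulli's inequality (1 + c)^v ≤ 1 + v c for 0 ≤ v ≤ 1, after taking logarithms. With c = σ⁻²
it produces the constant C. -/
lemma le_log_div_log {v c : ℝ} (hv0 : 0 ≤ v) (hv1 : v ≤ 1) (hc : 0 < c) :
    v ≤ 2 / Real.log (1 + c) * (1 / 2 * Real.log (1 + v * c)) := by
  have hl : 0 < Real.log (1 + c) := Real.log_pos (by linarith)
  have h := rpow_one_add_le_one_add_mul_self (s := c) (by linarith) hv0 hv1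
  have h2 := Real.log_le_log (Real.rpow_pos_of_pos (by linarith) _) h
  rw [Real.log_rpow (by linarith)] at h2
  have h3 : 2 / Real.log (1 + c) * (1 / 2 * Real.log (1 + v * c))
      = Real.log (1 + v * c) / Real.log (1 + c) := by
    field_simp
  rw [h3, le_div_iff₀ hl]
  exact h2

variable [MeasurableSpace X] [MeasurableSingletonClass X]

/-- The posterior variances at the arms played are bounded by the maximum information gain. -/
lemma sum_postKer_le {Ω : Type*} (m : X → ℝ) {k : X → X → ℝ} (hk : (Matrix.of k).PosSemidef)
    (hk1 : ∀ x, k x x ≤ 1) {σ : ℝ≥0} (hσ : 0 < σ) (am : (X → ℝ) → X) (ft : ℕ → Ω → X → ℝ)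
    (T : ℕ) (ω : Ω) :
    ∑ t ∈ Finset.range T, postKer k σ (armsBefore am ft t ω) (am (ft t ω)) (am (ft t ω))
      ≤ 2 / Real.log (1 + ((σ : ℝ) ^ 2)⁻¹) * maxInfoGain m k σ T := by
  have hc : 0 < ((σ : ℝ) ^ 2)⁻¹ := by positivity
  have hl : 0 < Real.log (1 + ((σ : ℝ) ^ 2)⁻¹) := Real.log_pos (by linarith)
  have h : ∀ n, ∑ t ∈ Finset.range n,
      postKer k σ (armsBefore am ft t ω) (am (ft t ω)) (am (ft t ω))
      ≤ 2 / Real.log (1 + ((σ : ℝ) ^ 2)⁻¹) * infoGain m k σ (armsBefore am ft n ω) := by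
    intro n
    induction n with
    | zero => simp [infoGain_zero m hσ]
    | succ n ih =>
      have hv := le_log_div_log (postKer_diag_nonneg hk hσ (armsBefore am ft n ω) (am (ft n ω)))
        ((postKer_diag_le hk hσ (armsBefore am ft n ω) (am (ft n ω))).trans (hk1 _)) hc
      rw [Finset.sum_range_succ, infoGain_succ m hk hσ, mul_add]
      exact add_le_add ih hv
  refine (h T).trans ?_
  gcongr
  exact infoGain_le_maxInfoGain m k σ le_rfl _

omit [DecidableEq X] [MeasurableSpace X] [MeasurableSingletonClass X] in
lemma beta_mono [Nonempty X] {s t : ℕ} (hs : 0 < s) (hst : s ≤ t) : beta X s ≤ beta X t := by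
  have hX : (0 : ℝ) < Fintype.card X := by exact_mod_cast Fintype.card_pos
  have hs' : (0 : ℝ) < s := by exact_mod_cast hs
  have hst' : (s : ℝ) ≤ t := by exact_mod_cast hst
  unfold beta
  gcongr

/-- The confidence widths at the arms played, summed over the rounds. -/
lemma sum_width_le {Ω : Type*} (m : X → ℝ) {k : X → X → ℝ} (hk : (Matrix.of k).PosSemidef)
    (hk1 : ∀ x, k x x ≤ 1) {σ : ℝ≥0} (hσ : 0 < σ) (am : (X → ℝ) → X) (ft : ℕ → Ω → X → ℝ)
    (T : ℕ) (ω : Ω) :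
    ∑ t ∈ Finset.range T, √(beta X (t + 1)) *
        √(postKer k σ (armsBefore am ft t ω) (am (ft t ω)) (am (ft t ω)))
      ≤ √(2 / Real.log (1 + ((σ : ℝ) ^ 2)⁻¹) * T * beta X T * maxInfoGain m k σ T) := by
  have : Nonempty X := ⟨am 0⟩
  set v : ℕ → ℝ := fun t => postKer k σ (armsBefore am ft t ω) (am (ft t ω)) (am (ft t ω)) with hv
  have hv0 : ∀ t, 0 ≤ v t := fun t => postKer_diag_nonneg hk hσ _ _
  have hsum := sum_postKer_le m hk hk1 hσ am ft T ω
  have h1 : ∑ t ∈ Finset.range T, √(beta X (t + 1)) * √(v t)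
      ≤ √(beta X T) * ∑ t ∈ Finset.range T, √(v t) := by
    rw [Finset.mul_sum]
    refine Finset.sum_le_sum fun t ht => ?_
    gcongr
    exact beta_mono t.succ_pos (Finset.mem_range.1 ht)
  refine h1.trans ?_
  -- If β_T ≤ 0, the factor √β_T is 0 by convention and already bounds the whole sum.
  rcases le_total (beta X T) 0 with hβ | hβ
  · rw [Real.sqrt_eq_zero_of_nonpos hβ, zero_mul]
    exact Real.sqrt_nonneg _
  · have h2 : ∑ t ∈ Finset.range T, √(v t) ≤ √(T * ∑ t ∈ Finset.range T, v t) := by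
      refine Real.le_sqrt_of_sq_le ?_
      have := sq_sum_le_card_mul_sum_sq (s := Finset.range T) (f := fun t => √(v t))
      simpa [Real.sq_sqrt (hv0 _)] using this
    calc _ ≤ √(beta X T) * √(T * ∑ t ∈ Finset.range T, v t) := by gcongr
      _ = √(beta X T * (T * ∑ t ∈ Finset.range T, v t)) := (Real.sqrt_mul hβ _).symm
      _ ≤ _ := by
        refine Real.sqrt_le_sqrt ?_
        calc beta X T * (T * ∑ t ∈ Finset.range T, v t)
            ≤ beta X T * (T * (2 / Real.log (1 + ((σ : ℝ) ^ 2)⁻¹) * maxInfoGain m k σ T)) := by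
              gcongr
          _ = _ := by ring

-- The reason for the choice of β: the Gaussian excess bound summed over all arms is an inverse
-- square of the round number.
omit [DecidableEq X] [MeasurableSpace X] [MeasurableSingletonClass X] in
lemma exp_neg_beta [Nonempty X] (t : ℕ) :
    (Fintype.card X : ℝ) * (Real.exp (-beta X (t + 1) / 2) / √(2 * Real.pi))
      = 1 / ((t : ℝ) + 1) ^ 2 := by
  have hX : (0 : ℝ) < Fintype.card X := by exact_mod_cast Fintype.card_pos
  have hp : 0 < √(2 * Real.pi) := by positivity
  have h : -beta X (t + 1) / 2 = -Real.log ((Fintype.card X : ℝ) * ((t : ℝ) + 1) ^ 2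
      / √(2 * Real.pi)) := by
    unfold beta
    push_cast
    ring
  rw [h, Real.exp_neg, Real.exp_log (by positivity)]
  field_simp

lemma sum_inv_sq_le (T : ℕ) :
    ∑ t ∈ Finset.range T, 1 / ((t : ℝ) + 1) ^ 2 ≤ Real.pi ^ 2 / 6 := by
  have h := sum_le_hasSum (Finset.range (T + 1)) (fun n _ => by positivity) hasSum_zeta_two
  -- The zeta series starts at n = 0 with the term 1/0² = 0, so dropping it shifts the index to `t +
  -- 1`.
  rw [Finset.sum_range_succ'] at h
  simpa using h

end InfoBound

/-! ### Integrability of rewards, posterior means and widths. -/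

section Integrability

/-- A random choice among finitely many integrable variables is a finite sum of restrictions to
events. It handles random arms, random priors and the random arm sequence at once. -/
lemma integrable_select {Ω A : Type*} [MeasurableSpace Ω] {μ : Measure Ω} [Fintype A]
    [MeasurableSpace A] [MeasurableSingletonClass A] {ξ : Ω → A} (hξ : Measurable ξ)
    {G : A → Ω → ℝ} (hG : ∀ a, Integrable (G a) μ) : Integrable (fun ω => G (ξ ω) ω) μ := by
  classical
  have h : (fun ω => G (ξ ω) ω) = fun ω => ∑ a, (ξ ⁻¹' {a}).indicator (G a) ω := by
    ext ω
    simp [Set.indicator_apply]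
  rw [h]
  exact integrable_finsetSum _ fun a _ => (hG a).indicator (hξ (measurableSet_singleton a))

variable {Ω X P : Type*} [MeasurableSpace Ω] [Fintype X] [DecidableEq X] [MeasurableSpace X]
  [MeasurableSingletonClass X] [Fintype P] [MeasurableSpace P] [MeasurableSingletonClass P]
  {P₁ : PMF P} {m : P → X → ℝ} {k : P → X → X → ℝ} {σ : ℝ≥0} {am : (X → ℝ) → X} {T : ℕ}
  {μ : Measure Ω} {pstar : Ω → P} {f : Ω → X → ℝ} {pt : ℕ → Ω → P} {ft : ℕ → Ω → X → ℝ}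
  {ε : ℕ → Ω → ℝ}

omit [MeasurableSpace X] [MeasurableSingletonClass X] in
lemma integrable_eval_gpLaw (m : X → ℝ) {k : X → X → ℝ} (hk : (Matrix.of k).PosSemidef) (x : X) :
    Integrable (fun g : X → ℝ => g x) (gpLaw m k) := by
  have h : Integrable (fun y : ℝ => y) ((gpLaw m k).map fun g => g x) := by
    rw [map_eval_gpLaw m hk]
    exact (memLp_id_gaussianReal (μ := m x) (v := (k x x).toNNReal) 1).integrable (by simp)
  exact (integrable_map_measure aestronglyMeasurable_id (measurable_pi_apply x).aemeasurable).1 h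

omit [MeasurableSpace X] [MeasurableSingletonClass X] in
lemma IsRun.integrable_f [IsProbabilityMeasure μ] (hk : ∀ p, (Matrix.of (k p)).PosSemidef)
    (hrun : IsRun P₁ m k σ am T μ pstar f pt ft ε) (x : X) : Integrable (fun ω => f ω x) μ := by
  have hf := hrun.measurable_f
  refine ⟨(by fun_prop : Measurable fun ω => f ω x).aestronglyMeasurable, ?_⟩
  rw [hasFiniteIntegral_iff_enorm, hrun.lintegral_prior (F := fun z => ‖z.2 x‖ₑ) (by fun_prop)]
  refine ENNReal.sum_lt_top.2 fun p _ => ENNReal.mul_lt_top (P₁.apply_lt_top p) ?_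
  exact (integrable_eval_gpLaw (m p) (hk p) x).hasFiniteIntegral

omit [MeasurableSpace X] [MeasurableSingletonClass X] [MeasurableSingletonClass P] in
lemma IsRun.integrable_noise [IsProbabilityMeasure μ]
    (hrun : IsRun P₁ m k σ am T μ pstar f pt ft ε) {t : ℕ} (ht : t < T) :
    Integrable (ε t) μ := by
  have h : Integrable (fun y : ℝ => y) (μ.map (ε t)) := by
    rw [(hrun.law_noise t ht).map_eq]
    exact (memLp_id_gaussianReal (μ := 0) (v := σ ^ 2) 1).integrable (by simp)
  exact (integrable_map_measure aestronglyMeasurable_id (hrun.measurable_noise t ht).aemeasurable).1 h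

lemma IsRun.integrable_reward [IsProbabilityMeasure μ] (hk : ∀ p, (Matrix.of (k p)).PosSemidef)
    (hrun : IsRun P₁ m k σ am T μ pstar f pt ft ε) (ham : Measurable am) {t : ℕ} (ht : t < T) :
    Integrable (fun ω => f ω (am (ft t ω))) μ :=
  integrable_select (G := fun x ω => f ω x) (ham.comp (hrun.measurable_ft t ht))
    (hrun.integrable_f hk)

lemma IsRun.integrable_optimum [IsProbabilityMeasure μ] (hk : ∀ p, (Matrix.of (k p)).PosSemidef)
    (hrun : IsRun P₁ m k σ am T μ pstar f pt ft ε) (ham : Measurable am) :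
    Integrable (fun ω => f ω (am (f ω))) μ :=
  integrable_select (G := fun x ω => f ω x) (ham.comp hrun.measurable_f) (hrun.integrable_f hk)

lemma IsRun.integrable_rewardsBefore [IsProbabilityMeasure μ]
    (hk : ∀ p, (Matrix.of (k p)).PosSemidef)
    (hrun : IsRun P₁ m k σ am T μ pstar f pt ft ε) (ham : Measurable am) {t : ℕ} (ht : t ≤ T)
    (i : Fin t) : Integrable (fun ω => rewardsBefore am f ft ε t ω i) μ :=
  (hrun.integrable_reward hk ham (i.2.trans_le ht)).add (hrun.integrable_noise (i.2.trans_le ht))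

omit [MeasurableSingletonClass P] in
lemma IsRun.measurable_armsBefore (hrun : IsRun P₁ m k σ am T μ pstar f pt ft ε)
    (ham : Measurable am) {t : ℕ} (ht : t ≤ T) : Measurable (armsBefore am ft t) :=
  (hrun.measurable_runHist ham ht).fst

/-- The posterior mean of a random prior at a random arm is integrable. -/
lemma IsRun.integrable_postMean [IsProbabilityMeasure μ]
    (hk : ∀ p, (Matrix.of (k p)).PosSemidef)
    (hrun : IsRun P₁ m k σ am T μ pstar f pt ft ε) (ham : Measurable am) {t : ℕ} (ht : t ≤ T)
    {ξ : Ω → P} (hξ : Measurable ξ) {η : Ω → X} (hη : Measurable η) :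
    Integrable (fun ω => postMean (m (ξ ω)) (k (ξ ω)) σ (armsBefore am ft t ω)
      (rewardsBefore am f ft ε t ω) (η ω)) μ := by
  have hA := hrun.measurable_armsBefore ham ht
  refine integrable_select (A := (P × X) × (Fin t → X))
    (G := fun a ω => postMean (m a.1.1) (k a.1.1) σ a.2 (rewardsBefore am f ft ε t ω) a.1.2)
    ((hξ.prodMk hη).prodMk hA) fun a => ?_
  -- With arms and prior fixed, the posterior mean is affine in the integrable rewards.
  unfold postMean
  simp only [dotProduct, Matrix.mulVec]
  refine (integrable_const _).add (integrable_finsetSum _ fun i _ =>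
    (integrable_finsetSum _ fun j _ => ?_).const_mul _)
  exact ((hrun.integrable_rewardsBefore hk ham ht j).sub (integrable_const _)).const_mul _

/-- The confidence width of a random prior at a random arm is integrable. -/
lemma IsRun.integrable_width [IsProbabilityMeasure μ]
    (hrun : IsRun P₁ m k σ am T μ pstar f pt ft ε) (ham : Measurable am) {t : ℕ} (ht : t ≤ T)
    (β : ℝ) {ξ : Ω → P} (hξ : Measurable ξ) {η : Ω → X} (hη : Measurable η) :
    Integrable (fun ω => √β * √(postKer (k (ξ ω)) σ (armsBefore am ft t ω) (η ω) (η ω))) μ :=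
  integrable_select (A := (P × X) × (Fin t → X))
    (G := fun a _ => √β * √(postKer (k a.1.1) σ a.2 a.1.2 a.1.2))
    ((hξ.prodMk hη).prodMk (hrun.measurable_armsBefore ham ht)) fun _ => integrable_const _

lemma IsRun.integrable_runUcb [IsProbabilityMeasure μ] (hk : ∀ p, (Matrix.of (k p)).PosSemidef)
    (hrun : IsRun P₁ m k σ am T μ pstar f pt ft ε) (ham : Measurable am) {t : ℕ} (ht : t ≤ T)
    {ξ : Ω → P} (hξ : Measurable ξ) {η : Ω → X} (hη : Measurable η) :
    Integrable (fun ω => runUcb (m (ξ ω)) (k (ξ ω)) σ am f ft ε t ω (η ω)) μ :=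
  (hrun.integrable_postMean hk ham ht hξ hη).add (hrun.integrable_width ham ht _ hξ hη)

end Integrability

/-! ### The outer terms of the regret decomposition, and averaging over the prior. -/

section Regret

variable {Ω X P : Type*} [MeasurableSpace Ω] [Fintype X] [DecidableEq X] [MeasurableSpace X]
  [MeasurableSingletonClass X] [Fintype P] [MeasurableSpace P] [MeasurableSingletonClass P]
  {P₁ : PMF P} {m : P → X → ℝ} {k : P → X → X → ℝ} {σ : ℝ≥0} {am : (X → ℝ) → X} {T : ℕ}
  {μ : Measure Ω} {pstar : Ω → P} {f : Ω → X → ℝ} {pt : ℕ → Ω → P} {ft : ℕ → Ω → X → ℝ}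
  {ε : ℕ → Ω → ℝ}

omit [DecidableEq X] in
lemma measurable_postMean_select (m : P → X → ℝ) (k : P → X → X → ℝ) (σ : ℝ≥0) (t : ℕ) :
    Measurable fun z : (P × X) × Hist X t =>
      postMean (m z.1.1) (k z.1.1) σ z.2.1 z.2.2 z.1.2 :=
  measurable_from_prod_countable_right fun a =>
    measurable_pi_iff.1 (measurable_postMean (m a.1) (k a.1) σ t) a.2

omit [DecidableEq X] in
lemma measurable_ucb_select (m : P → X → ℝ) (k : P → X → X → ℝ) (σ : ℝ≥0) (β : ℝ) (t : ℕ) :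
    Measurable fun z : (P × X) × Hist X t =>
      ucb (m z.1.1) (k z.1.1) σ β z.2.1 z.2.2 z.1.2 := by
  refine measurable_from_prod_countable_right fun a => ?_
  refine (measurable_pi_iff.1 (measurable_postMean (m a.1) (k a.1) σ t) a.2).add ?_
  exact (Measurable.of_discrete (f := fun xs : Fin t → X =>
    √β * √(postKer (k a.1) σ xs a.2 a.2))).comp measurable_fst

/-- The optimum rarely exceeds its upper confidence bound under the true prior. -/
lemma IsRun.integral_optimum_sub_runUcb_le [IsProbabilityMeasure μ]
    (hk : ∀ p, (Matrix.of (k p)).PosSemidef) (hk1 : ∀ p x, k p x x ≤ 1) (hσ : 0 < σ)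
    (hrun : IsRun P₁ m k σ am T μ pstar f pt ft ε) (ham : Measurable am) {t : ℕ} (ht : t ≤ T) :
    ∫ ω, (f ω (am (f ω)) - runUcb (m (pstar ω)) (k (pstar ω)) σ am f ft ε t ω (am (f ω))) ∂μ
      ≤ 1 / ((t : ℝ) + 1) ^ 2 := by
  have : Nonempty X := ⟨am 0⟩
  have hK := isMarkovKernel_hyperKernel P₁ m hk hσ t
  have hU := measurable_ucb_select m k σ (beta X (t + 1)) t
  -- The optimum depends on `f`, so its excess is bounded by the sum of the positive excesses over
  -- all arms; each of these is a one-dimensional Gaussian integral given the history and the prior.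
  set F : Hist X t × (P × (X → ℝ)) → ℝ≥0∞ := fun y => ∑ x, ENNReal.ofReal
    (y.2.2 x - ucb (m y.2.1) (k y.2.1) σ (beta X (t + 1)) y.1.1 y.1.2 x) with hFdef
  have hF : Measurable F := by
    refine Finset.measurable_sum _ fun x _ => Measurable.ennreal_ofReal (Measurable.sub
      (by fun_prop) ?_)
    exact hU.comp (f := fun y : Hist X t × (P × (X → ℝ)) => ((y.2.1, x), y.1)) (by fun_prop)
  have hle : ∫⁻ ω, ENNReal.ofReal (f ω (am (f ω))
      - runUcb (m (pstar ω)) (k (pstar ω)) σ am f ft ε t ω (am (f ω))) ∂μ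
      ≤ ENNReal.ofReal (1 / ((t : ℝ) + 1) ^ 2) := by
    calc _ ≤ ∫⁻ ω, F (runHist am f ft ε t ω, (pstar ω, f ω)) ∂μ := by
          refine lintegral_mono fun ω => ?_
          exact Finset.single_le_sum (f := fun x => ENNReal.ofReal (f ω x
            - runUcb (m (pstar ω)) (k (pstar ω)) σ am f ft ε t ω x)) (fun _ _ => zero_le)
            (Finset.mem_univ (am (f ω)))
      _ = ∫⁻ ω, ∫⁻ z, F (runHist am f ft ε t ω, z)
          ∂(hyperKernel P₁ m k σ t (runHist am f ft ε t ω)) ∂μ :=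
          hrun.lintegral_posterior hk hσ ham ht hF
      _ ≤ ∫⁻ _ω, ENNReal.ofReal (1 / ((t : ℝ) + 1) ^ 2) ∂μ := by
          refine lintegral_mono fun ω => ?_
          set h := runHist am f ft ε t ω
          have hp : ∀ p, ∫⁻ g, F (h, (p, g))
              ∂(gpLaw (postMean (m p) (k p) σ h.1 h.2) (postKer (k p) σ h.1))
              ≤ ENNReal.ofReal (1 / ((t : ℝ) + 1) ^ 2) := by
            intro p
            simp only [hFdef]
            rw [lintegral_finsetSum _ fun x _ => by fun_prop, ← exp_neg_beta (X := X) t,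
              ENNReal.ofReal_mul (by positivity), ENNReal.ofReal_natCast]
            refine (Finset.sum_le_card_nsmul _ _ _ fun x _ => ?_).trans_eq (nsmul_eq_mul _ _)
            have := lintegral_excess_gaussianReal (postMean (m p) (k p) σ h.1 h.2 x)
              (beta X (t + 1)) (postKer_diag_nonneg (hk p) hσ h.1 x)
              ((postKer_diag_le (hk p) hσ h.1 x).trans (hk1 p x))
            rw [← map_eval_gpLaw (postMean (m p) (k p) σ h.1 h.2)
              (postKer_posSemidef (hk p) hσ h.1) x, lintegral_map (by fun_prop) (by fun_prop)]
              at this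
            exact this
          rw [lintegral_hyperKernel P₁ m k σ t h (F := fun z => F (h, z))
            (hF.comp measurable_prodMk_left)]
          calc _ ≤ ∑ p, ENNReal.ofReal (hyperPost P₁ m k σ t h.1 h.2 p)
                * ENNReal.ofReal (1 / ((t : ℝ) + 1) ^ 2) := by
                gcongr with p
                exact hp p
            _ = _ := by
                rw [← Finset.sum_mul, ← ENNReal.ofReal_sum_of_nonneg
                  fun p _ => hyperPost_nonneg P₁ m k σ t h p, hyperPost_sum P₁ m hk hσ,
                  ENNReal.ofReal_one, one_mul]
      _ = _ := by simp
  have hint : Integrable (fun ω => f ω (am (f ω))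
      - runUcb (m (pstar ω)) (k (pstar ω)) σ am f ft ε t ω (am (f ω))) μ :=
    (hrun.integrable_optimum hk ham).sub (hrun.integrable_runUcb hk ham ht
      hrun.measurable_pstar (ham.comp hrun.measurable_f))
  refine (integral_mono hint hint.pos_part fun ω => le_max_left _ (0 : ℝ)).trans ?_
  rw [integral_eq_lintegral_of_nonneg_ae (Filter.Eventually.of_forall fun ω => le_max_right _ (0 : ℝ))
    hint.pos_part.aestronglyMeasurable]
  refine ENNReal.toReal_le_of_le_ofReal (by positivity) (le_trans (le_of_eq ?_) hle)
  refine lintegral_congr fun ω => ?_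
  rw [ENNReal.ofReal_max, ENNReal.ofReal_zero, max_eq_left zero_le]

/-- The expected reward is the expected posterior mean under the true prior. -/
lemma IsRun.integral_reward [IsProbabilityMeasure μ]
    (hk : ∀ p, (Matrix.of (k p)).PosSemidef) (hσ : 0 < σ)
    (hrun : IsRun P₁ m k σ am T μ pstar f pt ft ε) (ham : Measurable am) {t : ℕ} (ht : t < T) :
    ∫ ω, f ω (am (ft t ω)) ∂μ
      = ∫ ω, postMean (m (pstar ω)) (k (pstar ω)) σ (armsBefore am ft t ω)
          (rewardsBefore am f ft ε t ω) (am (ft t ω)) ∂μ := by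
  have hK := isMarkovKernel_hyperKernel P₁ m hk hσ t
  have hM := measurable_postMean_select m k σ t
  have hi1 := hrun.integrable_reward hk ham ht
  have hi2 := hrun.integrable_postMean hk ham ht.le hrun.measurable_pstar
    (η := fun ω => am (ft t ω)) (ham.comp (hrun.measurable_ft t ht))
  have hi : Integrable (fun ω => f ω (am (ft t ω)) - postMean (m (pstar ω)) (k (pstar ω)) σ
      (armsBefore am ft t ω) (rewardsBefore am f ft ε t ω) (am (ft t ω))) μ := hi1.sub hi2
  -- It suffices that the positive and negative parts of f(x_t) minus the posterior mean have equal
  -- integrals; both can be computed with the conditional law of the two pairs.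
  rw [← sub_eq_zero, ← integral_sub hi1 hi2,
    integral_eq_lintegral_pos_part_sub_lintegral_neg_part hi, sub_eq_zero]
  congr 1
  have hMm : Measurable fun y : Hist X t × ((P × (X → ℝ)) × (P × (X → ℝ))) =>
      postMean (m y.2.1.1) (k y.2.1.1) σ y.1.1 y.1.2 (am y.2.2.2) :=
    hM.comp (f := fun y : Hist X t × ((P × (X → ℝ)) × (P × (X → ℝ))) =>
      ((y.2.1.1, am y.2.2.2), y.1)) (by fun_prop)
  have hE : Measurable fun y : Hist X t × ((P × (X → ℝ)) × (P × (X → ℝ))) =>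
      y.2.1.2 (am y.2.2.2) :=
    measurable_eval_uncurry.comp (f := fun y : Hist X t × ((P × (X → ℝ)) × (P × (X → ℝ))) =>
      (y.2.1.2, am y.2.2.2)) (by fun_prop)
  have hF1 : Measurable fun y : Hist X t × ((P × (X → ℝ)) × (P × (X → ℝ))) =>
      ENNReal.ofReal (y.2.1.2 (am y.2.2.2)
        - postMean (m y.2.1.1) (k y.2.1.1) σ y.1.1 y.1.2 (am y.2.2.2)) :=
    (hE.sub hMm).ennreal_ofReal
  have hF2 : Measurable fun y : Hist X t × ((P × (X → ℝ)) × (P × (X → ℝ))) =>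
      ENNReal.ofReal (postMean (m y.2.1.1) (k y.2.1.1) σ y.1.1 y.1.2 (am y.2.2.2)
        - y.2.1.2 (am y.2.2.2)) :=
    (hMm.sub hE).ennreal_ofReal
  have e1 := hrun.lintegral_pair hk hσ ham ht hF1
  have e2 := hrun.lintegral_pair hk hσ ham ht hF2
  have e3 : ∀ ω, -(f ω (am (ft t ω)) - postMean (m (pstar ω)) (k (pstar ω)) σ
      (armsBefore am ft t ω) (rewardsBefore am f ft ε t ω) (am (ft t ω)))
      = postMean (m (pstar ω)) (k (pstar ω)) σ (armsBefore am ft t ω)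
        (rewardsBefore am f ft ε t ω) (am (ft t ω)) - f ω (am (ft t ω)) := fun ω => neg_sub _ _
  simp only [e3]
  refine e1.trans (Eq.trans ?_ e2.symm)
  refine lintegral_congr fun ω => ?_
  set h := runHist am f ft ε t ω
  -- Integrating the sample last fixes the arm, and the truth is then Gaussian there for each prior,
  -- so reflection about its mean applies.
  rw [lintegral_lintegral_swap (f := fun z w : P × (X → ℝ) => ENNReal.ofReal (z.2 (am w.2)
      - postMean (m z.1) (k z.1) σ h.1 h.2 (am w.2)))
      (hF1.comp (f := fun y : (P × (X → ℝ)) × (P × (X → ℝ)) => (h, y))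
        (by fun_prop)).aemeasurable,
    lintegral_lintegral_swap (f := fun z w : P × (X → ℝ) => ENNReal.ofReal
      (postMean (m z.1) (k z.1) σ h.1 h.2 (am w.2) - z.2 (am w.2)))
      (hF2.comp (f := fun y : (P × (X → ℝ)) × (P × (X → ℝ)) => (h, y))
        (by fun_prop)).aemeasurable]
  refine lintegral_congr fun w => ?_
  rw [lintegral_hyperKernel P₁ m k σ t h (F := fun z => ENNReal.ofReal (z.2 (am w.2)
      - postMean (m z.1) (k z.1) σ h.1 h.2 (am w.2))) (hF1.comp
        (f := fun z => (h, (z, w))) (by fun_prop)),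
    lintegral_hyperKernel P₁ m k σ t h (F := fun z => ENNReal.ofReal
      (postMean (m z.1) (k z.1) σ h.1 h.2 (am w.2) - z.2 (am w.2))) (hF2.comp
        (f := fun z => (h, (z, w))) (by fun_prop))]
  refine Finset.sum_congr rfl fun p _ => ?_
  congr 1
  have hs := lintegral_sub_gaussianReal_symm (postMean (m p) (k p) σ h.1 h.2 (am w.2))
    (postKer (k p) σ h.1 (am w.2) (am w.2)).toNNReal
  rw [← map_eval_gpLaw (postMean (m p) (k p) σ h.1 h.2) (postKer_posSemidef (hk p) hσ h.1),
    lintegral_map (by fun_prop) (by fun_prop), lintegral_map (by fun_prop) (by fun_prop)] at hs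
  exact hs

/-- The upper confidence bound of the sampled prior at the optimum exceeds the reward, in
expectation, by the confidence width of the true prior at the arm played. -/
lemma IsRun.integral_runUcb_sub_reward [IsProbabilityMeasure μ]
    (hk : ∀ p, (Matrix.of (k p)).PosSemidef) (hσ : 0 < σ)
    (hrun : IsRun P₁ m k σ am T μ pstar f pt ft ε) (ham : Measurable am) {t : ℕ} (ht : t < T) :
    ∫ ω, runUcb (m (pt t ω)) (k (pt t ω)) σ am f ft ε t ω (am (f ω)) ∂μ
        - ∫ ω, f ω (am (ft t ω)) ∂μ
      = ∫ ω, √(beta X (t + 1)) * √(postKer (k (pstar ω)) σ (armsBefore am ft t ω)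
          (am (ft t ω)) (am (ft t ω))) ∂μ := by
  have hG : Measurable fun y : Hist X t × ((P × (X → ℝ)) × (P × (X → ℝ))) =>
      ucb (m y.2.1.1) (k y.2.1.1) σ (beta X (t + 1)) y.1.1 y.1.2 (am y.2.2.2) :=
    (measurable_ucb_select m k σ (beta X (t + 1)) t).comp
      (f := fun y : Hist X t × ((P × (X → ℝ)) × (P × (X → ℝ))) =>
        ((y.2.1.1, am y.2.2.2), y.1)) (by fun_prop)
  -- The exchange turns the bound of the sampled prior at x* into that of the true prior at x_t.
  have h1 := hrun.integral_exchange hk hσ ham ht hG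
  have hx := ham.comp (hrun.measurable_ft t ht)
  have h2 := integral_add (hrun.integrable_postMean hk ham ht.le hrun.measurable_pstar hx)
    (hrun.integrable_width ham ht.le (beta X (t + 1)) hrun.measurable_pstar hx)
  have h3 := hrun.integral_reward hk hσ ham ht
  have h4 := h1.symm.trans h2
  rw [h3]
  refine sub_eq_of_eq_add (h4.trans ?_)
  exact add_comm _ _

omit [MeasurableSpace X] [MeasurableSingletonClass X] in
/-- The expectation of a nonnegative function of the true prior. -/
lemma IsRun.integral_comp_pstar [IsProbabilityMeasure μ]
    (hrun : IsRun P₁ m k σ am T μ pstar f pt ft ε) {φ : P → ℝ} (hφ : ∀ p, 0 ≤ φ p) :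
    ∫ ω, φ (pstar ω) ∂μ = ∑ p, (P₁ p).toReal * φ p := by
  have hφm : Measurable φ := Measurable.of_discrete
  rw [integral_eq_lintegral_of_nonneg_ae (Filter.Eventually.of_forall fun ω => hφ _)
    (hφm.comp hrun.measurable_pstar).aestronglyMeasurable,
    hrun.lintegral_prior (F := fun z => ENNReal.ofReal (φ z.1)) (by fun_prop)]
  simp only [lintegral_const, measure_univ, mul_one]
  rw [ENNReal.toReal_sum fun p _ => ENNReal.mul_ne_top (P₁.apply_ne_top p) ENNReal.ofReal_ne_top]
  simp [ENNReal.toReal_mul, hφ]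

-- Jensen's inequality for the concave square root. For a ≤ 0, which a negative β_T permits, every
-- root on the left is 0.
omit [MeasurableSpace P] [MeasurableSingletonClass P] in
lemma sum_mul_sqrt_le (P₁ : PMF P) {a : ℝ} {γ : P → ℝ} (hγ : ∀ p, 0 ≤ γ p) :
    ∑ p, (P₁ p).toReal * √(a * γ p) ≤ √(a * ∑ p, (P₁ p).toReal * γ p) := by
  rcases le_total a 0 with ha | ha
  · have : ∀ p, √(a * γ p) = 0 := fun p =>
      Real.sqrt_eq_zero_of_nonpos (mul_nonpos_of_nonpos_of_nonneg ha (hγ p))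
    simp only [this, mul_zero, Finset.sum_const_zero]
    exact Real.sqrt_nonneg _
  · have h := Real.strictConcaveOn_sqrt.concaveOn.le_map_sum (t := Finset.univ)
      (w := fun p => (P₁ p).toReal) (p := fun p => a * γ p) (fun p _ => ENNReal.toReal_nonneg)
      (sum_toReal_pmf P₁) (fun p _ => mul_nonneg ha (hγ p))
    simp only [smul_eq_mul] at h
    refine h.trans_eq ?_
    rw [Finset.mul_sum]
    congr 1
    exact Finset.sum_congr rfl fun p _ => by ring

end Regret

end
end HPGP

/-! ### The regret bound. -/

theorem mainTheorem2 {Ω X P : Type*} [MeasurableSpace Ω]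
    [Fintype X] [DecidableEq X] [MeasurableSpace X] [MeasurableSingletonClass X]
    [Fintype P] [MeasurableSpace P] [MeasurableSingletonClass P]
    (P₁ : PMF P) (m : P → X → ℝ) (k : P → X → X → ℝ)
    (hk : ∀ p, (Matrix.of (k p)).PosSemidef) (hk1 : ∀ p x, k p x x ≤ 1)
    (σ : ℝ≥0) (hσ : 0 < σ)
    (am : (X → ℝ) → X) (ham : Measurable am) (hmax : ∀ (g : X → ℝ) (x : X), g x ≤ g (am g))
    (T : ℕ) (μ : Measure Ω) [IsProbabilityMeasure μ]
    (pstar : Ω → P) (f : Ω → X → ℝ) (pt : ℕ → Ω → P) (ft : ℕ → Ω → X → ℝ) (ε : ℕ → Ω → ℝ)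
    (hrun : HPGP.IsRun P₁ m k σ am T μ pstar f pt ft ε) :
    Integrable (HPGP.regret am f ft T) μ ∧
    (∀ t ∈ Finset.range T, Integrable (fun ω =>
      HPGP.runUcb (m (pstar ω)) (k (pstar ω)) σ am f ft ε t ω (am (f ω))
        - HPGP.runUcb (m (pt t ω)) (k (pt t ω)) σ am f ft ε t ω (am (f ω))) μ) ∧
    ∫ ω, HPGP.regret am f ft T ω ∂μ ≤
      Real.pi ^ 2 / 6
      + ∑ t ∈ Finset.range T, ∫ ω,
          (HPGP.runUcb (m (pstar ω)) (k (pstar ω)) σ am f ft ε t ω (am (f ω))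
            - HPGP.runUcb (m (pt t ω)) (k (pt t ω)) σ am f ft ε t ω (am (f ω))) ∂μ
      + Real.sqrt (2 / Real.log (1 + ((σ : ℝ) ^ 2)⁻¹) * T * HPGP.beta X T
          * HPGP.avgMaxInfoGain P₁ m k σ T) := by
  have hf := hrun.measurable_f
  have hps := hrun.measurable_pstar
  have hreg : ∀ t ∈ Finset.range T,
      Integrable (fun ω => f ω (am (f ω)) - f ω (am (ft t ω))) μ := fun t ht =>
    (hrun.integrable_optimum hk ham).sub (hrun.integrable_reward hk ham (Finset.mem_range.1 ht))
  have hU1 : ∀ t ∈ Finset.range T, Integrable (fun ω =>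
      HPGP.runUcb (m (pstar ω)) (k (pstar ω)) σ am f ft ε t ω (am (f ω))) μ := fun t ht =>
    hrun.integrable_runUcb hk ham (Finset.mem_range.1 ht).le hps (ham.comp hf)
  have hU2 : ∀ t ∈ Finset.range T, Integrable (fun ω =>
      HPGP.runUcb (m (pt t ω)) (k (pt t ω)) σ am f ft ε t ω (am (f ω))) μ := fun t ht =>
    hrun.integrable_runUcb hk ham (Finset.mem_range.1 ht).le
      (hrun.measurable_pt t (Finset.mem_range.1 ht)) (ham.comp hf)
  refine ⟨integrable_finsetSum _ hreg, fun t ht => (hU1 t ht).sub (hU2 t ht), ?_⟩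
  set a : ℝ := 2 / Real.log (1 + ((σ : ℝ) ^ 2)⁻¹) * T * HPGP.beta X T with ha
  set γ : P → ℝ := fun p => HPGP.maxInfoGain (m p) (k p) σ T with hγdef
  have hγ : ∀ p, 0 ≤ γ p := fun p => HPGP.maxInfoGain_nonneg (m p) (k p) hσ T
  set W : ℕ → Ω → ℝ := fun t ω => √(HPGP.beta X (t + 1)) * √(HPGP.postKer (k (pstar ω)) σ
    (HPGP.armsBefore am ft t ω) (am (ft t ω)) (am (ft t ω))) with hWdef
  have hW : ∀ t ∈ Finset.range T, Integrable (W t) μ := fun t ht =>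
    hrun.integrable_width ham (Finset.mem_range.1 ht).le _ hps (η := fun ω => am (ft t ω))
      (ham.comp (hrun.measurable_ft t (Finset.mem_range.1 ht)))
  -- The three-term decomposition in expectation: excess at the optimum, the retained difference of
  -- confidence bounds, and the width under the true prior.
  have hround : ∀ t ∈ Finset.range T, ∫ ω, (f ω (am (f ω)) - f ω (am (ft t ω))) ∂μ
      ≤ 1 / ((t : ℝ) + 1) ^ 2
        + ∫ ω, (HPGP.runUcb (m (pstar ω)) (k (pstar ω)) σ am f ft ε t ω (am (f ω))
            - HPGP.runUcb (m (pt t ω)) (k (pt t ω)) σ am f ft ε t ω (am (f ω))) ∂μ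
        + ∫ ω, W t ω ∂μ := by
    intro t ht
    have htT := Finset.mem_range.1 ht
    have hopt := hrun.integrable_optimum hk ham
    have h1 := hrun.integral_optimum_sub_runUcb_le hk hk1 hσ ham htT.le
    have h2 := hrun.integral_runUcb_sub_reward hk hσ ham htT
    rw [integral_sub hopt (hU1 t ht)] at h1
    rw [integral_sub hopt (hrun.integrable_reward hk ham htT), integral_sub (hU1 t ht) (hU2 t ht)]
    linarith
  have hwidth : ∑ t ∈ Finset.range T, ∫ ω, W t ω ∂μ
      ≤ √(a * HPGP.avgMaxInfoGain P₁ m k σ T) := by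
    rw [← integral_finsetSum _ hW]
    calc ∫ ω, ∑ t ∈ Finset.range T, W t ω ∂μ
        ≤ ∫ ω, √(a * γ (pstar ω)) ∂μ := by
          refine integral_mono (integrable_finsetSum _ hW)
            (HPGP.integrable_select (G := fun p _ => √(a * γ p)) hps fun _ =>
              integrable_const _) fun ω => ?_
          -- The width bound is deterministic for each prior, so it can be applied at each outcome
          -- with the prior p*(ω).
          exact HPGP.sum_width_le (m (pstar ω)) (hk _) (hk1 _) hσ am ft T ω
      _ = ∑ p, (P₁ p).toReal * √(a * γ p) :=
          hrun.integral_comp_pstar (φ := fun p => √(a * γ p)) fun _ => Real.sqrt_nonneg _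
      _ ≤ _ := HPGP.sum_mul_sqrt_le P₁ hγ
  calc ∫ ω, HPGP.regret am f ft T ω ∂μ
      = ∑ t ∈ Finset.range T, ∫ ω, (f ω (am (f ω)) - f ω (am (ft t ω))) ∂μ :=
        integral_finsetSum _ hreg
    _ ≤ _ := Finset.sum_le_sum hround
    _ ≤ _ := by
        rw [Finset.sum_add_distrib, Finset.sum_add_distrib]
        gcongr
        exact HPGP.sum_inv_sq_le T
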